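/- **Notation.** $(x)_n=x(x+1)\cdots(x+n-1)$, $(x)_0=1$. For $b_0,\dots,b_d\ge 0$ not all zero let $T=\{i: b_i>0\}$; the Dirichlet distribution $\mathcal D(b_0,\dots,b_d)$ on $\mathbb R^{d+1}$ is the law of the vector whose coordinates outside $T$ vanish and whose coordinates in $T$ are positive, sum to $1$, and are such that, for $i_0=\min T$, the coordinates $(x_i)_{i\in T\setminus\{i_0\}}$ have density $$\frac{\Gamma(\sum_{i\in T}b_i)}{\prod_{i\in T}\Gamma(b_i)}\prod_{i\in T}x_i^{b_i-1},\qquad x_{i_0}=1-\sum_{i\in T\setminus\{i_0\}}x_i,$$ on the set where $x_i>0$ for all $i\in T$ (it is a point mass $\delta_{e_{i_0}}$ if $T=\{i_0\}$). For a positive integer $k$ and $a_0,\dots,a_d\ge 0$ with $a=a_0+\cdots+a_d>0$, the quasi Bernoulli distribution of order $k$ is $$\mathcal B_k(a_0,\dots,a_d)=\frac{k!}{(a)_k}\sum_{\substack{(b_0,\dots,b_d)\in\mathbb N^{d+1}\\ b_0+\cdots+b_d=k}}\ \prod_{i=0}^d\frac{(a_i)_{b_i}}{b_i!}\ \mathcal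 D(b_0,\dots,b_d).$$ **Theorem 5.1.** Let $\alpha$ be a measure on a measurable space $\Omega$ with $0<a=\alpha(\Omega)<\infty$, and let $k$ be a positive integer. Then there exist, on some probability space, random variables $(M,X,W)$ such that: 1. $M=(M_1,\dots,M_k)\in\mathbb N^k$ satisfies $M_1+2M_2+\cdots+kM_k=k$ almost surely and has the Ewens distribution with parameters $k$ and $a$: for all $m\in\mathbb N^k$ with $m_1+2m_2+\cdots+km_k=k$, $$\Pr(M=m)=\frac{k!}{\prod_{j=1}^k j^{m_j}m_j!}\cdot\frac{a^{m_1+\cdots+m_k}}{(a)_k}.$$ Write $S_j=M_1+\cdots+M_j$ (so $S_0=0$) and $B(M)=(b_t)_{t=1}^{S_k}$, where $b_t=j$ for $S_{j-1}<t\le S_j$. 2. Conditionally on $M$, the variables $X=(X_t)_{t=1}^{S_k}$ are i.i.d. in $\Omega$ with law $\alpha/a$. 3. Conditionally on $M$, $W=(W_t)_{t=1}^{S_k}\sim\mathcal D(B(M))$. 4. Conditionally on $M$, $X$ and $W$ are independent. Moreover, for any random variables $(M,X,W)$ on any probability space satisfying 1–4, $P=\sum_{t=1}^{S_k}W_t\,\delta_{X_t}$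 (where negative weights, which occur with probability $0$, are replaced by $0$) is a random probability on $\Omega$ (a measurable random measure that is almost surely a probability measure), and it is a quasi Bernoulli process: for every $d\ge 0$ and every partition $(A_0,\dots,A_d)$ of $\Omega$ into measurable sets (some possibly empty), $$(P(A_0),\dots,P(A_d))\sim\mathcal B_k(\alpha(A_0),\dots,\alpha(A_d)).$$ -/

import Mathlib

open MeasureTheory ProbabilityTheory
open scoped BigOperators ENNReal Nat

universe u v

namespace QuasiBernoulli

noncomputable section

/-- The point of `ℝ^ι` whose coordinates in the support `T = {i | 0 < a i}`, apart from the
distinguished index `i₀ ∈ T`, are given by `x`, whose coordinate `i₀` makes the coordinates sum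
to one, and whose coordinates outside `T` vanish. -/
def simplexPoint {ι : Type*} [Fintype ι] (a : ι → ℝ) (i₀ : ι)
    (x : {i : ι // 0 < a i ∧ i ≠ i₀} → ℝ) (i : ι) : ℝ :=
  open Classical in
  if h : 0 < a i ∧ i ≠ i₀ then x ⟨i, h⟩ else if i = i₀ then 1 - ∑ j, x j else 0

/-- The Dirichlet density in the free coordinates `x_i`, `i ∈ T \ {i₀}`, with
`x_{i₀} = 1 - ∑ x_i`:
`Γ(∑_{i ∈ T} a_i) / ∏_{i ∈ T} Γ(a_i) * ∏_{i ∈ T} x_i ^ (a_i - 1)` where all `x_i > 0`, `i ∈ T`,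
and zero elsewhere. -/
def dirichletDensity {ι : Type*} [Fintype ι] (a : ι → ℝ) (i₀ : ι)
    (x : {i : ι // 0 < a i ∧ i ≠ i₀} → ℝ) : ℝ≥0∞ :=
  open Classical in
  if ∀ i, 0 < a i → 0 < simplexPoint a i₀ x i then
    ENNReal.ofReal
      (Real.Gamma (∑ i with 0 < a i, a i) / (∏ i with 0 < a i, Real.Gamma (a i)) *
        ∏ i with 0 < a i, simplexPoint a i₀ x i ^ (a i - 1))
  else 0

/-- The Dirichlet distribution `D(a_0, …, a_{n-1})` on the simplex of `ℝ^n`, for parameters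
`a_i ≥ 0` not all zero. It is carried by the face spanned by the `e_i` with `a_i > 0`; the free
coordinates on that face are all but the first one. (Junk value `0` if no `a_i` is positive.) -/
def dirichlet {n : ℕ} (a : Fin n → ℝ) : Measure (Fin n → ℝ) :=
  open Classical in
  if h : (Finset.univ.filter fun i => 0 < a i).Nonempty then
    let i₀ : Fin n := (Finset.univ.filter fun i => 0 < a i).min' h
    ((volume : Measure ({i : Fin n // 0 < a i ∧ i ≠ i₀} → ℝ)).withDensity
      (dirichletDensity a i₀)).map (simplexPoint a i₀)
  else 0

/-- The Pochhammer symbol `(x)_n = x (x + 1) ⋯ (x + n - 1)`. -/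
def poch (x : ℝ) (n : ℕ) : ℝ := (ascPochhammer ℝ n).eval x

/-- The quasi Bernoulli distribution `B_k(a_0, …, a_d)` of order `k`, for `a_i ≥ 0` not all zero:
the mixture of the Dirichlet distributions `D(b_0, …, b_d)`, `b ∈ ℕ^{d+1}`, `∑ b_i = k`, with
weights `k! / (a)_k * ∏ (a_i)_{b_i} / b_i!`, where `a = ∑ a_i`. -/
def quasiBernoulli (k : ℕ) {n : ℕ} (a : Fin n → ℝ) : Measure (Fin n → ℝ) :=
  ∑ b ∈ Finset.piAntidiag (Finset.univ : Finset (Fin n)) k,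
    ENNReal.ofReal ((k ! : ℝ) / poch (∑ i, a i) k * ∏ i, poch (a i) (b i) / ((b i)! : ℝ)) •
      dirichlet fun i => (b i : ℝ)

/-- `C(m) = k! / ∏_j j^{m_j} m_j!`. The entry `m j`, `j : Fin k`, stands for `m_{j+1}`. -/
def ewensCoeff {k : ℕ} (m : Fin k → ℕ) : ℝ :=
  (k ! : ℝ) / ∏ j : Fin k, ((j : ℝ) + 1) ^ m j * ((m j)! : ℝ)

/-- The Ewens distribution with parameters `k` and `a` on the `m ∈ ℕ^k` with
`m_1 + 2 m_2 + ⋯ + k m_k = k`. -/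
def ewens (k : ℕ) (a : ℝ) : Measure (Fin k → ℕ) :=
  Measure.sum fun m : {m : Fin k → ℕ // ∑ j : Fin k, ((j : ℕ) + 1) * m j = k} =>
    ENNReal.ofReal (ewensCoeff m.1 * a ^ (∑ j, m.1 j) / poch a k) • Measure.dirac m.1

/-- `S_j = m_1 + ⋯ + m_j`. -/
def partialSum {k : ℕ} (m : Fin k → ℕ) (j : ℕ) : ℕ :=
  ∑ i ∈ Finset.univ.filter (fun i : Fin k => (i : ℕ) < j), m i

/-- The number `S_k = m_1 + ⋯ + m_k` of parts of the partition coded by `m`. -/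
def numParts {k : ℕ} (m : Fin k → ℕ) : ℕ := partialSum m k

/-- The parts in increasing order: indices start at `0`, so `part m t` is `b_{t+1}`, namely the
`j` with `S_{j-1} < t + 1 ≤ S_j`, i.e. the least `j` with `t < S_j` (for `t < S_k`). -/
def part {k : ℕ} (m : Fin k → ℕ) (t : ℕ) : ℕ := sInf {j : ℕ | t < partialSum m j}

/-- The random variables `(M, X, W)`, on a probability space `(Θ, μ)`. Only the `X_t` and
`W_t` with `t < S_k(M)` are constrained (indices `t` start at `0`). The law of `(X, W)` given `M`
is specified on each event `{M = m}` of positive probability. -/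
structure IsEwensSelection {Ω Θ : Type*} [MeasurableSpace Ω] [MeasurableSpace Θ]
    (k : ℕ) (α : Measure Ω) (μ : Measure Θ)
    (M : Θ → Fin k → ℕ) (X : ℕ → Θ → Ω) (W : ℕ → Θ → ℝ) : Prop where
  measurable_M : Measurable M
  measurable_X : ∀ t, Measurable (X t)
  measurable_W : ∀ t, Measurable (W t)
  /-- `M` has the Ewens distribution with parameters `k` and `a = α(Ω)`. -/
  law_M : HasLaw M (ewens k (α.real Set.univ)) μ
  /-- Given `M`, each `X_t` has law `α / a`. -/
  law_X : ∀ m, μ (M ⁻¹' {m}) ≠ 0 → ∀ t < numParts m,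
    HasLaw (X t) ((α Set.univ)⁻¹ • α) (cond μ (M ⁻¹' {m}))
  /-- Given `M`, the `X_t` are independent. -/
  indep_X : ∀ m, μ (M ⁻¹' {m}) ≠ 0 →
    iIndepFun (fun t : Fin (numParts m) => X t) (cond μ (M ⁻¹' {m}))
  /-- Given `M`, the vector `W` has law `D(B(M))`. -/
  law_W : ∀ m, μ (M ⁻¹' {m}) ≠ 0 →
    HasLaw (fun θ (t : Fin (numParts m)) => W t θ)
      (dirichlet fun t : Fin (numParts m) => (part m t : ℝ)) (cond μ (M ⁻¹' {m}))
  /-- Given `M`, the vectors `X` and `W` are independent. -/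
  indep_X_W : ∀ m, μ (M ⁻¹' {m}) ≠ 0 →
    IndepFun (fun θ (t : Fin (numParts m)) => X t θ) (fun θ (t : Fin (numParts m)) => W t θ)
      (cond μ (M ⁻¹' {m}))

/-- The random measure `P = ∑_t W_t δ_{X_t}`, the sum being over the `S_k(M)` parts. -/
def randomMeasure {Ω Θ : Type*} [MeasurableSpace Ω] {k : ℕ}
    (M : Θ → Fin k → ℕ) (X : ℕ → Θ → Ω) (W : ℕ → Θ → ℝ) (θ : Θ) : Measure Ω :=
  ∑ t ∈ Finset.range (numParts (M θ)), ENNReal.ofReal (W t θ) • Measure.dirac (X t θ)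

/-- `P` is a quasi Bernoulli process `B_k(α)`: a random probability such that
`(P(A_0), …, P(A_d)) ~ B_k(α(A_0), …, α(A_d))` for every finite measurable partition. -/
structure IsQuasiBernoulliProcess {Ω Θ : Type*} [MeasurableSpace Ω] [MeasurableSpace Θ]
    (k : ℕ) (α : Measure Ω) (μ : Measure Θ) (P : Θ → Measure Ω) : Prop where
  measurable : Measurable P
  isProbabilityMeasure : ∀ᵐ θ ∂μ, IsProbabilityMeasure (P θ)
  law : ∀ (d : ℕ) (A : Fin (d + 1) → Set Ω), (∀ i, MeasurableSet (A i)) →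
    Pairwise (fun i j => Disjoint (A i) (A j)) → ⋃ i, A i = Set.univ →
    HasLaw (fun θ i => (P θ).real (A i)) (quasiBernoulli k fun i => α.real (A i)) μ

end

end QuasiBernoulli

/-! Given `M = m`, each part independently falls in the cell `A i` with probability `α (A i) / a`.
Sorting the parts by cell turns `(P(A_0), …, P(A_d))` into the sums of the coordinates of `W` over
the colour classes. The Dirichlet law is stable under such sums (`map_fiberSum_dirichlet`), so given
the partition and its colouring the vector has law `D(b)`, where `b i` is the total size of the
parts of colour `i`. It remains to find the law of `b`.

That law comes from the cycle index identity `sum_cycleMonomial_eq`. With `p_j = ∑ a_i x_i^j`, the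
series `exp (∑_j p_j t^j / j)` equals `∏_i (1 - x_i t)^{-a_i}`. The coefficient of `t^k` on the left
is a sum over partitions of `k` with Ewens weights, and expanding the powers of the `p_j` colours
the parts. On the right it is the sum over compositions with weights `∏ (a_i)_{b_i} / b_i!`. No
power series are used: both families of coefficients satisfy Newton's recursion `n h_n = ∑_j p_j
h_{n-j}`, which determines them. A linear functional on polynomials then replaces `x^b` by an
arbitrary `Φ b` (`sum_ewens_coloring`).

Aggregation rests on writing a Dirichlet vector with natural parameters as normalized independent
gamma variables (`dirichlet_natCast_eq`). Only integer shapes occur, so additivity of the gamma laws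
follows from convolution with the exponential law and from characteristic functions. Summing over
`m` gives the law of the process; existence is an explicit mixture of product measures. -/

namespace QuasiBernoulli

/-! ### Partitions coded by multiplicities. -/

/-- The weight `m_1 + 2 m_2 + ⋯ + K m_K`. -/
def weight {K : ℕ} (m : Fin K → ℕ) : ℕ := ∑ j : Fin K, ((j : ℕ) + 1) * m j

theorem le_weight {K : ℕ} (m : Fin K → ℕ) (j : Fin K) : m j ≤ weight m :=
  calc m j ≤ ((j : ℕ) + 1) * m j := Nat.le_mul_of_pos_left _ (Nat.succ_pos _)
    _ ≤ _ := Finset.single_le_sum (f := fun j : Fin K => ((j : ℕ) + 1) * m j)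
      (fun _ _ => Nat.zero_le _) (Finset.mem_univ j)

/-- The finitely many `m : Fin K → ℕ` of weight `n`. -/
def ofWeight (K n : ℕ) : Finset (Fin K → ℕ) :=
  (Fintype.piFinset fun _ => Finset.range (n + 1)).filter fun m => weight m = n

@[simp] theorem mem_ofWeight {K n : ℕ} {m : Fin K → ℕ} : m ∈ ofWeight K n ↔ weight m = n := by
  simp only [ofWeight, Finset.mem_filter, Fintype.mem_piFinset, Finset.mem_range,
    and_iff_right_iff_imp]
  rintro rfl j
  exact Nat.lt_succ_of_le (le_weight m j)

theorem weight_add_single {K : ℕ} (m : Fin K → ℕ) (j : Fin K) :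
    weight (m + Pi.single j 1) = weight m + (j + 1) := by
  simp [weight, mul_add, Finset.sum_add_distrib, Pi.single_apply]

/-! ### Newton's recursion and the cycle index identity. -/

section Recursion

variable {R : Type*} [CommRing R] [Algebra ℝ R]

/-- Each step of the recursion can be divided by `n + 1`, since `R` is a real algebra. The bound `K`
is there because with only `K` part sizes the partition sums satisfy the recursion only for `n < K`.
-/
theorem eq_of_newton_recursion {p u v : ℕ → R} {K : ℕ} (h0 : u 0 = v 0)
    (hu : ∀ n < K, ((n + 1 : ℕ) : ℝ) • u (n + 1) =
      ∑ j ∈ Finset.range (n + 1), p (j + 1) * u (n - j))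
    (hv : ∀ n < K, ((n + 1 : ℕ) : ℝ) • v (n + 1) =
      ∑ j ∈ Finset.range (n + 1), p (j + 1) * v (n - j)) :
    ∀ n ≤ K, u n = v n := by
  intro n
  induction n using Nat.strong_induction_on with
  | _ n ih =>
    intro hn
    cases n with
    | zero => exact h0
    | succ n =>
      have h : ((n + 1 : ℕ) : ℝ) • u (n + 1) = ((n + 1 : ℕ) : ℝ) • v (n + 1) := by
        rw [hu n (by omega), hv n (by omega)]
        refine Finset.sum_congr rfl fun j _ => ?_
        rw [ih (n - j) (by omega) (by omega)]
      have hne : ((n + 1 : ℕ) : ℝ) ≠ 0 := by positivity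
      have h' := congrArg (fun x => ((n + 1 : ℕ) : ℝ)⁻¹ • x) h
      simpa only [smul_smul, inv_mul_cancel₀ hne, one_smul] using h'

/-- The monomial `∏_j (p_j / j)^{m_j} / m_j!`. -/
noncomputable def cycleMonomial {K : ℕ} (p : ℕ → R) (m : Fin K → ℕ) : R :=
  ∏ j : Fin K, (((j : ℝ) + 1) ^ m j * ((m j)! : ℝ))⁻¹ • p (j + 1) ^ m j

/-- One more part of size `j + 1` multiplies the denominator by exactly `(j + 1) (m j + 1)`, which
the scalar on the left cancels. -/
theorem cycleMonomial_add_single {K : ℕ} (p : ℕ → R) (m : Fin K → ℕ) (j : Fin K) :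
    (((j : ℝ) + 1) * ((m + Pi.single j 1 : Fin K → ℕ) j : ℝ)) • cycleMonomial p (m + Pi.single j 1) =
      p (j + 1) * cycleMonomial p m := by
  classical
  have hrest : ∏ i ∈ Finset.univ.erase j,
      ((((i : ℝ) + 1) ^ (m + Pi.single j 1 : Fin K → ℕ) i * (((m + Pi.single j 1 : Fin K → ℕ) i)! : ℝ))⁻¹ •
        p (i + 1) ^ (m + Pi.single j 1 : Fin K → ℕ) i) =
      ∏ i ∈ Finset.univ.erase j, (((i : ℝ) + 1) ^ m i * ((m i)! : ℝ))⁻¹ • p (i + 1) ^ m i := by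
    refine Finset.prod_congr rfl fun i hi => ?_
    simp [Pi.single_eq_of_ne (Finset.ne_of_mem_erase hi)]
  unfold cycleMonomial
  rw [← Finset.mul_prod_erase _ _ (Finset.mem_univ j), hrest,
    ← Finset.mul_prod_erase _ _ (Finset.mem_univ j), ← smul_mul_assoc, ← mul_assoc]
  congr 1
  simp only [Pi.add_apply, Pi.single_eq_same, smul_smul, Nat.factorial_succ, mul_smul_comm]
  rw [pow_succ' (p _)]
  congr 1
  have : (j : ℝ) + 1 ≠ 0 := by positivity
  have : ((m j)! : ℝ) ≠ 0 := by positivity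
  push_cast
  field_simp
  ring

/-- Write the factor `n + 1` as `∑_j (j + 1) m_j` and remove one part of size `j + 1` from the
`j`-th term. The hypothesis `n < K` makes every part size up to `n + 1` available. -/
theorem sum_cycleMonomial_recursion {K : ℕ} (p : ℕ → R) (n : ℕ) (hn : n < K) :
    ((n + 1 : ℕ) : ℝ) • ∑ m ∈ ofWeight K (n + 1), cycleMonomial p m =
      ∑ j ∈ Finset.range (n + 1), p (j + 1) * ∑ m ∈ ofWeight K (n - j), cycleMonomial p m := by
  have key : ∀ j : Fin K, ∑ m ∈ ofWeight K (n + 1),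
      (((j : ℝ) + 1) * (m j : ℕ)) • cycleMonomial p m =
      if (j : ℕ) < n + 1 then p (j + 1) * ∑ m ∈ ofWeight K (n - j), cycleMonomial p m else 0 := by
    intro j
    split_ifs with hj
    · rw [Finset.mul_sum]
      symm
      -- The partitions missed by this injection have `m j = 0`, and their terms vanish.
      refine Finset.sum_of_injOn (fun m => m + Pi.single j 1) ?_ ?_ ?_ ?_
      · intro a _ b _ h
        exact add_right_cancel h
      · intro m hm
        simp only [Finset.mem_coe, mem_ofWeight] at hm ⊢
        rw [weight_add_single, hm]
        omega
      · intro m hm hm'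
        rcases Nat.eq_zero_or_pos (m j) with h0 | hpos
        · simp [h0]
        · refine absurd ?_ hm'
          have hle : Pi.single j 1 ≤ m := by
            intro i
            by_cases h : i = j
            · subst h; simpa using Nat.succ_le_of_lt hpos
            · simp [h]
          refine ⟨m - Pi.single j 1, ?_, tsub_add_cancel_of_le hle⟩
          have h2 := weight_add_single (m - Pi.single j 1) j
          rw [tsub_add_cancel_of_le hle] at h2
          simp only [Finset.mem_coe, mem_ofWeight] at hm ⊢
          omega
      · intro m _
        exact (cycleMonomial_add_single p m j).symm
    · refine Finset.sum_eq_zero fun m hm => ?_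
      have hm0 : m j = 0 := by
        by_contra h
        have h1 : ((j : ℕ) + 1) * m j ≤ weight m :=
          Finset.single_le_sum (f := fun j : Fin K => ((j : ℕ) + 1) * m j)
            (fun _ _ => Nat.zero_le _) (Finset.mem_univ j)
        have h2 : (j : ℕ) + 1 ≤ ((j : ℕ) + 1) * m j :=
          Nat.le_mul_of_pos_right _ (Nat.pos_of_ne_zero h)
        rw [mem_ofWeight] at hm
        omega
      simp [hm0]
  have h1 : ((n + 1 : ℕ) : ℝ) • ∑ m ∈ ofWeight K (n + 1), cycleMonomial p m =
      ∑ j : Fin K, ∑ m ∈ ofWeight K (n + 1),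
        (((j : ℝ) + 1) * (m j : ℕ)) • cycleMonomial p m := by
    rw [Finset.sum_comm, Finset.smul_sum]
    refine Finset.sum_congr rfl fun m hm => ?_
    rw [← Finset.sum_smul, ← mem_ofWeight.1 hm, weight]
    push_cast
    rfl
  rw [h1, Finset.sum_congr rfl fun j _ => key j,
    Fin.sum_univ_eq_sum_range (fun j => if j < n + 1 then
      p (j + 1) * ∑ m ∈ ofWeight K (n - j), cycleMonomial p m else 0) K, ← Finset.sum_filter]
  refine Finset.sum_congr ?_ fun _ _ => rfl
  ext j
  simp
  omega

theorem poch_succ (x : ℝ) (n : ℕ) : poch x (n + 1) = poch x n * (x + n) := by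
  simp [poch, ascPochhammer_succ_eval]

@[simp] theorem poch_zero (x : ℝ) : poch x 0 = 1 := by simp [poch]

theorem poch_pos {x : ℝ} (hx : 0 < x) (n : ℕ) : 0 < poch x n := ascPochhammer_pos n x hx

theorem poch_nonneg {x : ℝ} (hx : 0 ≤ x) (n : ℕ) : 0 ≤ poch x n := by
  induction n with
  | zero => simp
  | succ n ih => rw [poch_succ]; positivity

/-- This is the coefficient form of `t d/dt (1 - t)^{-x} = x t/(1 - t) · (1 - t)^{-x}`, proved by
induction after reversing the sum. -/
theorem mul_poch_div_factorial (x : ℝ) (n : ℕ) :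
    (n : ℝ) * (poch x n / (n ! : ℝ)) =
      ∑ j ∈ Finset.range n, x * (poch x (n - 1 - j) / ((n - 1 - j)! : ℝ)) := by
  rw [Finset.sum_range_reflect (fun j => x * (poch x j / (j ! : ℝ)))]
  induction n with
  | zero => simp
  | succ n ih =>
    rw [Finset.sum_range_succ, ← ih, poch_succ, Nat.factorial_succ]
    have : (n ! : ℝ) ≠ 0 := by positivity
    push_cast
    field_simp
    ring

/-- The monomial `∏_i (a_i)_{b_i} / b_i! x_i^{b_i}`. -/
noncomputable def pochMonomial {ι : Type*} [Fintype ι] (a : ι → ℝ) (x : ι → R) (b : ι → ℕ) : R :=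
  ∏ i, (poch (a i) (b i) / ((b i)! : ℝ)) • x i ^ b i

theorem smul_pochMonomial {ι : Type*} [Fintype ι] [DecidableEq ι] (a : ι → ℝ) (x : ι → R)
    (b : ι → ℕ) (i : ι) :
    ((b i : ℕ) : ℝ) • pochMonomial a x b = ∑ j ∈ Finset.range (b i),
      (a i • x i ^ (j + 1)) * pochMonomial a x (Function.update b i (b i - 1 - j)) := by
  have h : ∀ c, pochMonomial a x (Function.update b i c) =
      ((poch (a i) c / (c ! : ℝ)) • x i ^ c) *
      ∏ l ∈ Finset.univ.erase i, (poch (a l) (b l) / ((b l)! : ℝ)) • x l ^ b l := by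
    intro c
    rw [pochMonomial, ← Finset.mul_prod_erase _ _ (Finset.mem_univ i)]
    congr 1
    · simp
    · refine Finset.prod_congr rfl fun l hl => ?_
      simp [Function.update_of_ne (Finset.ne_of_mem_erase hl)]
  have h' := h (b i)
  rw [Function.update_eq_self] at h'
  simp_rw [h, h']
  simp_rw [← mul_assoc]
  rw [← Finset.sum_mul, ← smul_mul_assoc]
  congr 1
  rw [smul_smul, mul_poch_div_factorial, Finset.sum_smul]
  refine Finset.sum_congr rfl fun j hj => ?_
  have hj := Finset.mem_range.1 hj
  rw [smul_mul_smul_comm, ← pow_add]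
  congr 2
  omega

/-- Write `n + 1 = ∑_i b_i` and apply the one-variable recursion in coordinate `i`, which lowers `b
i` by `j + 1`. Reindexing by `b ↦ b + (j + 1) e_i` shows that the role of `p_{j+1}` is played by `∑
a_i x_i^{j+1}`. -/
theorem sum_pochMonomial_recursion {ι : Type*} [Fintype ι] [DecidableEq ι] (a : ι → ℝ) (x : ι → R)
    (n : ℕ) :
    ((n + 1 : ℕ) : ℝ) •
        ∑ b ∈ Finset.piAntidiag (Finset.univ : Finset ι) (n + 1), pochMonomial a x b =
      ∑ j ∈ Finset.range (n + 1), (∑ i, a i • x i ^ (j + 1)) *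
        ∑ b ∈ Finset.piAntidiag (Finset.univ : Finset ι) (n - j), pochMonomial a x b := by
  have h1 : ((n + 1 : ℕ) : ℝ) •
      ∑ b ∈ Finset.piAntidiag (Finset.univ : Finset ι) (n + 1), pochMonomial a x b =
      ∑ i, ∑ b ∈ Finset.piAntidiag (Finset.univ : Finset ι) (n + 1),
        ((b i : ℕ) : ℝ) • pochMonomial a x b := by
    rw [Finset.sum_comm, Finset.smul_sum]
    refine Finset.sum_congr rfl fun b hb => ?_
    rw [← Finset.sum_smul, ← Nat.cast_sum, (Finset.mem_piAntidiag.1 hb).1]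
  have h2 : ∀ i, ∀ b ∈ Finset.piAntidiag (Finset.univ : Finset ι) (n + 1),
      ((b i : ℕ) : ℝ) • pochMonomial a x b = ∑ j ∈ Finset.range (n + 1), if j < b i then
        (a i • x i ^ (j + 1)) * pochMonomial a x (Function.update b i (b i - 1 - j)) else 0 := by
    intro i b hb
    rw [smul_pochMonomial, ← Finset.sum_filter]
    refine Finset.sum_congr ?_ fun _ _ => rfl
    have hle : b i ≤ n + 1 := by
      rw [← (Finset.mem_piAntidiag.1 hb).1]
      exact Finset.single_le_sum (fun _ _ => Nat.zero_le _) (Finset.mem_univ i)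
    ext j
    simp
    omega
  rw [h1]
  simp_rw [Finset.sum_mul]
  rw [Finset.sum_comm (s := Finset.range (n + 1))]
  refine Finset.sum_congr rfl fun i _ => ?_
  rw [Finset.sum_congr rfl (h2 i), Finset.sum_comm]
  refine Finset.sum_congr rfl fun j hj => ?_
  have hj := Finset.mem_range.1 hj
  rw [Finset.mul_sum]
  symm
  refine Finset.sum_of_injOn (fun b => b + Pi.single i (j + 1)) ?_ ?_ ?_ ?_
  · intro a _ b _ h
    exact add_right_cancel h
  · intro b hb
    simp only [Finset.mem_coe, Finset.mem_piAntidiag, Finset.mem_univ, implies_true,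
      and_true] at hb ⊢
    simp [Finset.sum_add_distrib, hb]
    omega
  · intro b hb hb'
    split_ifs with hlt
    · refine absurd ?_ hb'
      have hle : Pi.single i (j + 1) ≤ b := by
        intro l
        by_cases h : l = i
        · subst h; simpa using hlt
        · simp [h]
      refine ⟨b - Pi.single i (j + 1), ?_, tsub_add_cancel_of_le hle⟩
      have h3 : ∑ l, (b - Pi.single i (j + 1) + Pi.single i (j + 1) : ι → ℕ) l = n + 1 := by
        rw [tsub_add_cancel_of_le hle]
        exact (Finset.mem_piAntidiag.1 hb).1
      simp only [Pi.add_apply, Finset.sum_add_distrib, Finset.sum_pi_single', Finset.mem_univ,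
        if_true] at h3
      simp only [Finset.mem_coe, Finset.mem_piAntidiag, Finset.mem_univ, implies_true, and_true]
      change ∑ l, (b - Pi.single i (j + 1) : ι → ℕ) l = n - j
      omega
    · rfl
  · intro b _
    have h4 : Function.update (b + Pi.single i (j + 1)) i
        ((b + Pi.single i (j + 1) : ι → ℕ) i - 1 - j) = b := by
      ext l
      by_cases h : l = i
      · subst h; simp
      · simp [h]
    rw [h4, if_pos (by simp; omega)]

/-- The cycle index identity: a sum over partitions of `n` equals a sum over compositions. -/
theorem sum_cycleMonomial_eq {ι : Type*} [Fintype ι] [DecidableEq ι] (a : ι → ℝ) (x : ι → R)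
    (n : ℕ) :
    ∑ m ∈ ofWeight n n, cycleMonomial (fun j => ∑ i, a i • x i ^ j) m =
      ∑ b ∈ Finset.piAntidiag (Finset.univ : Finset ι) n, pochMonomial a x b := by
  refine eq_of_newton_recursion (K := n) (p := fun j => ∑ i, a i • x i ^ j)
    (u := fun l => ∑ m ∈ ofWeight n l, cycleMonomial (fun j => ∑ i, a i • x i ^ j) m)
    (v := fun l => ∑ b ∈ Finset.piAntidiag (Finset.univ : Finset ι) l, pochMonomial a x b)
    ?_ (fun l hl => sum_cycleMonomial_recursion _ l hl)
    (fun l _ => sum_pochMonomial_recursion a x l) n le_rfl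
  have : ofWeight n 0 = {0} := by
    ext m
    simp only [mem_ofWeight, Finset.mem_singleton]
    constructor
    · intro h
      ext j
      have := le_weight m j
      simp
      omega
    · rintro rfl
      simp [weight]
  simp [this, cycleMonomial, pochMonomial]

end Recursion

/-! ### The list of parts of a partition. -/

section Parts

theorem partialSum_zero {k : ℕ} (m : Fin k → ℕ) : partialSum m 0 = 0 := by simp [partialSum]

theorem partialSum_succ {k : ℕ} (m : Fin k → ℕ) (j : Fin k) :
    partialSum m (j + 1) = partialSum m j + m j := by
  unfold partialSum
  have : Finset.univ.filter (fun i : Fin k => (i : ℕ) < j + 1) =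
      insert j (Finset.univ.filter fun i : Fin k => (i : ℕ) < j) := by
    ext i
    simp [Fin.ext_iff]
    omega
  rw [this, Finset.sum_insert (by simp), add_comm]

theorem partialSum_mono {k : ℕ} (m : Fin k → ℕ) : Monotone (partialSum m) := by
  intro i j hij
  refine Finset.sum_le_sum_of_subset fun l hl => ?_
  simp only [Finset.mem_filter, Finset.mem_univ, true_and] at hl ⊢
  omega

theorem part_eq {k : ℕ} (m : Fin k → ℕ) (j t : ℕ) (h1 : partialSum m j ≤ t)
    (h2 : t < partialSum m (j + 1)) : part m t = j + 1 := by
  refine le_antisymm (Nat.sInf_le h2) (Nat.succ_le_of_lt ?_)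
  by_contra! h
  have hmem : t < partialSum m (part m t) := 
    Nat.sInf_mem (s := {j : ℕ | t < partialSum m j}) ⟨j + 1, h2⟩
  have := partialSum_mono m h
  omega

theorem numParts_eq {k : ℕ} (m : Fin k → ℕ) : numParts m = ∑ j, m j := by
  unfold numParts partialSum
  congr 1
  ext i
  simp

/-- The parts form consecutive blocks, the next one consisting of `m j` parts equal to `j + 1`. The
default value `1` is never reached when `j ≤ k`. -/
theorem prod_part_aux {R : Type*} [CommMonoid R] {k : ℕ} (m : Fin k → ℕ) (g : ℕ → R) :
    ∀ j ≤ k, ∏ t ∈ Finset.range (partialSum m j), g (part m t) =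
      ∏ i ∈ Finset.range j, if h : i < k then g (i + 1) ^ m ⟨i, h⟩ else 1 := by
  intro j
  induction j with
  | zero => simp [partialSum_zero]
  | succ j ih =>
    intro hj
    rw [Finset.prod_range_succ, ← ih (by omega), partialSum_succ m ⟨j, hj⟩, Finset.prod_range_add,
      dif_pos (Nat.lt_of_succ_le hj)]
    congr 1
    rw [Finset.prod_congr rfl (g := fun _ => g (j + 1)), Finset.prod_const, Finset.card_range]
    intro t ht
    have ht := Finset.mem_range.1 ht
    rw [part_eq m j _ (Nat.le_add_right _ _)]
    have := partialSum_succ m ⟨j, hj⟩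
    simp only at this
    omega

theorem prod_part {R : Type*} [CommMonoid R] {k : ℕ} (m : Fin k → ℕ) (g : ℕ → R) :
    ∏ t : Fin (numParts m), g (part m t) = ∏ j : Fin k, g (j + 1) ^ m j := by
  rw [Fin.prod_univ_eq_prod_range (fun t => g (part m t)), numParts, prod_part_aux m g k le_rfl,
    Finset.prod_range]
  refine Finset.prod_congr rfl fun j _ => ?_
  simp

theorem sum_part {k : ℕ} (m : Fin k → ℕ) : ∑ t : Fin (numParts m), part m t = weight m := by
  -- The product formula in `Multiplicative ℕ` is the required sum formula.
  have := prod_part m (fun j => Multiplicative.ofAdd j)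
  rw [← ofAdd_sum] at this
  simp_rw [← ofAdd_nsmul] at this
  rw [← ofAdd_sum] at this
  rw [Multiplicative.ofAdd.injective this, weight]
  refine Finset.sum_congr rfl fun j _ => ?_
  simp [mul_comm]

end Parts

/-! ### Coloured Ewens partitions. -/

/-- The total of `b` on each fibre of `f`. -/
def fiberSum {ι κ S : Type*} [Fintype ι] [DecidableEq κ] [AddCommMonoid S] (f : ι → κ) (b : ι → S)
    (i : κ) : S := ∑ t with f t = i, b t

/-- Colouring the parts of an Ewens partition independently, according to `a`. -/
theorem sum_ewens_coloring {ι : Type*} [Fintype ι] [DecidableEq ι] (k : ℕ) (a : ι → ℝ)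
    (Φ : (ι → ℕ) → ℝ) :
    ∑ m ∈ ofWeight k k, ewensCoeff m * ∑ f : Fin (numParts m) → ι,
      (∏ t, a (f t)) * Φ (fiberSum f fun t => part m t) =
    ∑ b ∈ Finset.piAntidiag (Finset.univ : Finset ι) k,
      ((k ! : ℝ) * ∏ i, poch (a i) (b i) / ((b i)! : ℝ)) * Φ b := by
  have key := sum_cycleMonomial_eq a (fun i => (MvPolynomial.X i : MvPolynomial ι ℝ)) k
  -- Since `Φ` is arbitrary, the polynomial identity is transferred by the linear map that sends the
  -- monomial `x^b` to `Φ b`.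
  let L : MvPolynomial ι ℝ →ₗ[ℝ] ℝ :=
    (MvPolynomial.basisMonomials ι ℝ).constr ℝ fun b => Φ fun i => b i
  have hL : ∀ b : ι → ℕ, L (∏ i, MvPolynomial.X i ^ b i) = Φ b := by
    intro b
    have : ∏ i, (MvPolynomial.X i : MvPolynomial ι ℝ) ^ b i =
        MvPolynomial.basisMonomials ι ℝ (Finsupp.equivFunOnFinite.symm b) := by
      simp only [MvPolynomial.coe_basisMonomials, MvPolynomial.monomial_eq]
      simp [Finsupp.prod_fintype]
    rw [this, Module.Basis.constr_basis]
    rfl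
  have key2 := congrArg (fun q => (k ! : ℝ) * L q) key
  simp only [map_sum, Finset.mul_sum] at key2
  convert key2 using 1
  · refine Finset.sum_congr rfl fun m _ => ?_
    have h1 : cycleMonomial (fun j => ∑ i, a i • (MvPolynomial.X i : MvPolynomial ι ℝ) ^ j) m =
        (∏ j : Fin k, ((j : ℝ) + 1) ^ m j * ((m j)! : ℝ))⁻¹ •
          ∏ j : Fin k, (∑ i, a i • (MvPolynomial.X i : MvPolynomial ι ℝ) ^ ((j : ℕ) + 1)) ^ m j := by
      rw [cycleMonomial, ← Finset.prod_inv_distrib, Finset.prod_smul]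
    -- One factor `∑ a_i x_i^j` for each part: distributing the product chooses a colour for each
    -- part, hence a sum over `f`.
    rw [h1, ← prod_part m fun j => ∑ i, a i • (MvPolynomial.X i : MvPolynomial ι ℝ) ^ j,
      Finset.prod_univ_sum, map_smul, map_sum, smul_eq_mul, ← mul_assoc, ← div_eq_mul_inv]
    rw [Fintype.piFinset_univ, ewensCoeff]
    congr 1
    refine Finset.sum_congr rfl fun f _ => ?_
    rw [Finset.prod_smul, map_smul, smul_eq_mul]
    congr 1
    rw [← hL]
    congr 1
    rw [← Finset.prod_fiberwise_of_maps_to (t := Finset.univ) (g := f)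
      (fun _ _ => Finset.mem_univ _)]
    refine Finset.prod_congr rfl fun i _ => ?_
    rw [fiberSum, ← Finset.prod_pow_eq_pow_sum]
    refine Finset.prod_congr rfl fun t ht => ?_
    rw [(Finset.mem_filter.1 ht).2]
  · refine Finset.sum_congr rfl fun b _ => ?_
    rw [pochMonomial, Finset.prod_smul, map_smul, hL, smul_eq_mul, mul_assoc]

/-- With a single colour and `Φ = 1`, only one composition is left. This normalizes the Ewens
weights. -/
theorem sum_ewensCoeff (k : ℕ) (a : ℝ) :
    ∑ m ∈ ofWeight k k, ewensCoeff m * a ^ (∑ j, m j) = poch a k := by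
  have h := sum_ewens_coloring (ι := Unit) k (fun _ => a) (fun _ => 1)
  have h2 : Finset.piAntidiag (Finset.univ : Finset Unit) k = {fun _ => k} := by
    ext b
    simp only [Finset.mem_piAntidiag, Finset.mem_singleton, funext_iff]
    simp
    exact ⟨fun h _ => h, fun h => h ()⟩
  rw [h2] at h
  simp only [Finset.prod_const, Finset.card_univ, Fintype.card_fin, numParts_eq, mul_one,
    Finset.sum_const, Fintype.card_pi, Fintype.card_unit, Finset.sum_singleton,
    one_smul, one_pow] at h
  rw [h]
  have : (k ! : ℝ) ≠ 0 := by positivity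
  field_simp

/-! ### Gamma distributions with integer shape. -/

section Erlang

/-- The density `x ^ n e^{-x} / n!` on `(0, ∞)`. -/
noncomputable def erlangPDF (n : ℕ) (x : ℝ) : ℝ≥0∞ :=
  if 0 < x then ENNReal.ofReal (x ^ n * Real.exp (-x) / (n ! : ℝ)) else 0

/-- The gamma distribution with natural shape parameter `n` and unit scale, a point mass at zero
for `n = 0`. -/
noncomputable def erlang : ℕ → Measure ℝ
  | 0 => Measure.dirac 0
  | n + 1 => volume.withDensity (erlangPDF n)

@[fun_prop]
theorem measurable_erlangPDF (n : ℕ) : Measurable (erlangPDF n) :=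
  Measurable.ite measurableSet_Ioi (by fun_prop) measurable_const

theorem lintegral_erlangPDF_zero : ∫⁻ x, erlangPDF 0 x = 1 := by
  have h : erlangPDF 0 = (Set.Ioi (0 : ℝ)).indicator fun x => ENNReal.ofReal (Real.exp (-x)) := by
    ext x
    simp [erlangPDF, Set.indicator_apply]
  rw [h, lintegral_indicator measurableSet_Ioi, ← ofReal_integral_eq_lintegral_ofReal,
    integral_exp_neg_Ioi_zero, ENNReal.ofReal_one]
  · exact integrableOn_exp_neg_Ioi 0
  · exact Filter.Eventually.of_forall fun x => (Real.exp_pos _).le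

theorem lconvolution_erlangPDF (n : ℕ) :
    lconvolution (erlangPDF n) (erlangPDF 0) volume = erlangPDF (n + 1) := by
  ext x
  rw [lconvolution_def]
  -- The exponentials combine to `e^{-x}`, free of `y`, so only the integral of `y ^ n` over `(0,
  -- x)` remains.
  have h : ∀ y, erlangPDF n y * erlangPDF 0 (-y + x) = (Set.Ioo 0 x).indicator
      (fun y => ENNReal.ofReal (y ^ n * (Real.exp (-x) / (n ! : ℝ)))) y := by
    intro y
    by_cases hy : 0 < y <;> by_cases hx : y < x
    · rw [erlangPDF, erlangPDF, if_pos hy, if_pos (by linarith),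
        Set.indicator_of_mem (Set.mem_Ioo.2 ⟨hy, hx⟩), ← ENNReal.ofReal_mul (by positivity)]
      congr 1
      have : Real.exp (-x) = Real.exp (-y) * Real.exp (-(-y + x)) := by
        rw [← Real.exp_add]; congr 1; ring
      rw [this]
      simp
      ring
    · rw [erlangPDF, erlangPDF, if_neg (by linarith : ¬ 0 < -y + x),
        Set.indicator_of_notMem (fun h => hx h.2), mul_zero]
    all_goals rw [erlangPDF, if_neg hy, Set.indicator_of_notMem (fun h => hy h.1), zero_mul]
  simp_rw [h]
  rw [lintegral_indicator measurableSet_Ioo]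
  by_cases hx : 0 < x
  · rw [← ofReal_integral_eq_lintegral_ofReal, ← integral_Ioc_eq_integral_Ioo,
      ← intervalIntegral.integral_of_le hx.le, intervalIntegral.integral_mul_const, integral_pow,
      erlangPDF, if_pos hx]
    · congr 1
      rw [Nat.factorial_succ]
      push_cast
      have : (n ! : ℝ) ≠ 0 := by positivity
      have : (n : ℝ) + 1 ≠ 0 := by positivity
      field_simp
      simp
    · exact ((continuous_pow n).mul continuous_const).integrableOn_Icc.mono_set
        Set.Ioo_subset_Icc_self
    · refine (ae_restrict_iff' measurableSet_Ioo).2 (Filter.Eventually.of_forall fun y hy => ?_)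
      have := hy.1
      simp only [Pi.zero_apply]
      positivity
  · rw [Set.Ioo_eq_empty (fun h => hx h), erlangPDF, if_neg hx]
    simp

instance (n : ℕ) : SFinite (erlang n) := by
  cases n <;> (unfold erlang; infer_instance)

theorem erlang_succ_conv (n : ℕ) : (erlang (n + 1)).conv (erlang 1) = erlang (n + 2) := by
  simp only [erlang]
  rw [conv_withDensity_eq_lconvolution (by fun_prop) (by fun_prop), lconvolution_erlangPDF]

/-- Only shape `1` needs an integral; higher shapes are convolutions of probability measures. -/
instance isProbabilityMeasure_erlang (n : ℕ) : IsProbabilityMeasure (erlang n) := by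
  induction n with
  | zero => unfold erlang; infer_instance
  | succ n ih =>
    have h1 : IsProbabilityMeasure (erlang 1) :=
      ⟨by simp [erlang, lintegral_erlangPDF_zero]⟩
    cases n with
    | zero => exact h1
    | succ n =>
      rw [← erlang_succ_conv]
      infer_instance

theorem erlang_conv (n : ℕ) : (erlang n).conv (erlang 1) = erlang (n + 1) := by
  cases n with
  | zero =>
    have : erlang 0 = Measure.dirac 0 := rfl
    rw [this, Measure.dirac_zero_conv]
  | succ n => exact erlang_succ_conv n

theorem charFunDual_erlang (n : ℕ) (L : StrongDual ℝ ℝ) :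
    charFunDual (erlang n) L = charFunDual (erlang 1) L ^ n := by
  induction n with
  | zero =>
    have : erlang 0 = Measure.dirac 0 := rfl
    rw [this, charFunDual_dirac]
    simp
  | succ n ih => rw [← erlang_conv, charFunDual_conv, ih, pow_succ]

theorem ae_erlang_nonneg (n : ℕ) : ∀ᵐ x ∂(erlang n), 0 ≤ x := by
  cases n with
  | zero =>
    have : erlang 0 = Measure.dirac 0 := rfl
    rw [this]
    exact (ae_dirac_iff measurableSet_Ici).2 le_rfl
  | succ n =>
    refine (ae_withDensity_iff (measurable_erlangPDF n)).2 (Filter.Eventually.of_forall ?_)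
    intro x hx
    by_contra h
    exact hx (if_neg fun h' => h h'.le)

theorem ae_erlang_pos {n : ℕ} (hn : 0 < n) : ∀ᵐ x ∂(erlang n), 0 < x := by
  cases n with
  | zero => omega
  | succ n =>
    refine (ae_withDensity_iff (measurable_erlangPDF n)).2 (Filter.Eventually.of_forall ?_)
    intro x hx
    by_contra h
    exact hx (if_neg h)

end Erlang

/-! ### Additivity of independent gamma variables. -/

section FiberSum

variable {ι κ : Type*} [Fintype ι] [DecidableEq κ]

@[fun_prop]
theorem measurable_fiberSum (f : ι → κ) : Measurable (fiberSum f : (ι → ℝ) → κ → ℝ) :=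
  measurable_pi_lambda _ fun _ => Finset.measurable_sum _ fun t _ => measurable_pi_apply t

theorem sum_fiberSum [Fintype κ] {S : Type*} [AddCommMonoid S] (f : ι → κ) (b : ι → S) :
    ∑ i, fiberSum f b i = ∑ t, b t :=
  Finset.sum_fiberwise_of_maps_to (fun _ _ => Finset.mem_univ _) _

/-- Independent gamma variables are additive. -/
theorem map_fiberSum_pi_erlang [Fintype κ] (f : ι → κ) (b : ι → ℕ) :
    (Measure.pi fun t => erlang (b t)).map (fiberSum f) =
      Measure.pi fun i => erlang (fiberSum f b i) := by
  classical
  let L : (ι → ℝ) →L[ℝ] (κ → ℝ) :=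
    ContinuousLinearMap.pi fun i => ∑ t with f t = i, ContinuousLinearMap.proj t
  have hL : (fiberSum f : (ι → ℝ) → κ → ℝ) = L := by
    ext x i
    simp [fiberSum, L]
  have : IsProbabilityMeasure ((Measure.pi fun t => erlang (b t)).map (fiberSum f)) :=
    Measure.isProbabilityMeasure_map (measurable_fiberSum f).aemeasurable
  refine Measure.ext_of_charFunDual (funext fun ξ => ?_)
  rw [hL, charFunDual_map, charFunDual_pi, charFunDual_pi]
  -- After pullback along `L`, the coordinate `t` is tested by the component of `ξ` at `f t`. The
  -- characteristic function is then a product of powers, grouped by fibres.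
  have hs : ∀ t, (ξ.comp L).comp (.single ℝ (fun _ => ℝ) t) =
      ξ.comp (.single ℝ (fun _ => ℝ) (f t)) := by
    intro t
    ext
    simp only [ContinuousLinearMap.comp_apply]
    congr 1
    ext i
    by_cases h : f t = i
    · subst h
      simp [L, Pi.single_apply, Finset.sum_ite_eq']
    · simp [L, Pi.single_apply, Finset.sum_ite_eq', h, Ne.symm h]
  simp_rw [hs]
  rw [Finset.prod_congr rfl fun t _ => charFunDual_erlang (b t)
    (ξ.comp (.single ℝ (fun _ => ℝ) (f t)))]
  rw [← Finset.prod_fiberwise_of_maps_to (t := Finset.univ) (g := f)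
    (fun _ _ => Finset.mem_univ _)]
  refine Finset.prod_congr rfl fun i _ => ?_
  rw [charFunDual_erlang (fiberSum f b i), fiberSum, ← Finset.prod_pow_eq_pow_sum]
  refine Finset.prod_congr rfl fun t ht => ?_
  rw [(Finset.mem_filter.1 ht).2]

end FiberSum

/-! ### Densities and iterated integrals on finite products. -/

section PiDensity

theorem lintegral_fin_prod_eq_prod {E : Type*} [MeasurableSpace E] {μ : Measure E} [SigmaFinite μ]
    {n : ℕ} (f : Fin n → E → ℝ≥0∞) (hf : ∀ i, Measurable (f i)) :
    ∫⁻ x : Fin n → E, ∏ i, f i (x i) ∂(Measure.pi fun _ => μ) = ∏ i, ∫⁻ x, f i x ∂μ := by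
  induction n with
  | zero => simp
  | succ n ih =>
    rw [← ((measurePreserving_piFinSuccAbove (fun _ => μ) 0).symm).lintegral_comp_emb
      (MeasurableEquiv.measurableEmbedding _)]
    simp_rw [MeasurableEquiv.piFinSuccAbove_symm_apply, Fin.insertNthEquiv,
      Fin.prod_univ_succ, Fin.insertNth_zero, Equiv.coe_fn_mk, Fin.cons_succ, Fin.cons_zero]
    rw [← ih (fun i => f i.succ) fun i => hf i.succ]
    exact lintegral_prod_mul (hf 0).aemeasurable (Finset.measurable_prod _ fun (i : Fin n) _ =>
      (hf i.succ).comp (measurable_pi_apply i)).aemeasurable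

theorem lintegral_fintype_prod_eq_prod {ι : Type*} [Fintype ι] {E : Type*} [MeasurableSpace E]
    {μ : Measure E} [SigmaFinite μ] (f : ι → E → ℝ≥0∞) (hf : ∀ i, Measurable (f i)) :
    ∫⁻ x : ι → E, ∏ i, f i (x i) ∂(Measure.pi fun _ => μ) = ∏ i, ∫⁻ x, f i x ∂μ := by
  let e := (Fintype.equivFin ι).symm
  rw [← (measurePreserving_piCongrLeft (fun _ => μ) e).lintegral_comp_emb
    (MeasurableEquiv.measurableEmbedding _)]
  simp_rw [← e.prod_comp, MeasurableEquiv.coe_piCongrLeft, Equiv.piCongrLeft_apply_apply]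
  exact lintegral_fin_prod_eq_prod _ fun i => hf _

theorem pi_withDensity {ι : Type*} [Fintype ι] {E : Type*} [MeasurableSpace E]
    {μ : Measure E} [SigmaFinite μ] (g : ι → E → ℝ≥0∞) (hg : ∀ i, Measurable (g i))
    [∀ i, SigmaFinite (μ.withDensity (g i))] :
    Measure.pi (fun i => μ.withDensity (g i)) =
      (Measure.pi fun _ => μ).withDensity fun x => ∏ i, g i (x i) := by
  refine Measure.pi_eq fun s hs => ?_
  rw [withDensity_apply _ (MeasurableSet.univ_pi hs),
    ← lintegral_indicator (MeasurableSet.univ_pi hs)]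
  have h : (Set.univ.pi s).indicator (fun x : ι → E => ∏ i, g i (x i)) =
      fun x => ∏ i, (s i).indicator (g i) (x i) := by
    ext x
    by_cases hx : x ∈ Set.univ.pi s
    · rw [Set.indicator_of_mem hx]
      exact Finset.prod_congr rfl fun i _ => (Set.indicator_of_mem (hx i trivial) _).symm
    · rw [Set.indicator_of_notMem hx]
      simp only [Set.mem_pi, Set.mem_univ, true_implies, not_forall] at hx
      obtain ⟨i, hi⟩ := hx
      exact (Finset.prod_eq_zero (Finset.mem_univ i) (Set.indicator_of_notMem hi _)).symm
  rw [h, lintegral_fintype_prod_eq_prod _ fun i => (hg i).indicator (hs i)]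
  refine Finset.prod_congr rfl fun i _ => ?_
  rw [withDensity_apply _ (hs i), lintegral_indicator (hs i)]

theorem lintegral_pi_option {J E : Type*} [Fintype J] [MeasurableSpace E]
    (μ : Option J → Measure E) [∀ t, SigmaFinite (μ t)] {G : (Option J → E) → ℝ≥0∞}
    (hG : Measurable G) :
    ∫⁻ y, G y ∂(Measure.pi μ) = ∫⁻ x : J → E, ∫⁻ s, G (fun t => t.elim s x) ∂(μ none)
      ∂(Measure.pi fun j => μ (some j)) := by
  have hm : Measurable fun p : (J → E) × E => (fun t : Option J => t.elim p.2 p.1) := by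
    refine measurable_pi_lambda _ fun t => ?_
    cases t with
    | none => exact measurable_snd
    | some j => exact (measurable_pi_apply j).comp measurable_fst
  have h : Measure.pi μ = ((Measure.pi fun j => μ (some j)).prod (μ none)).map
      fun p : (J → E) × E => (fun t : Option J => t.elim p.2 p.1) := by
    refine Measure.pi_eq fun s hs => ?_
    have hpre : (fun p : (J → E) × E => (fun t : Option J => t.elim p.2 p.1)) ⁻¹'
        Set.univ.pi s = (Set.univ.pi fun j => s (some j)) ×ˢ s none := by
      ext p
      simp [Set.mem_pi, Option.forall, and_comm]
    rw [Measure.map_apply hm (MeasurableSet.univ_pi hs), hpre, Measure.prod_prod, Measure.pi_pi,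
      Fintype.prod_option, mul_comm]
  rw [h, lintegral_map hG hm]
  exact lintegral_prod _ (hG.comp hm).aemeasurable

end PiDensity

/-! ### Normalized gamma vectors and the Dirichlet density. -/

section Normalization

/-- The vector `y` divided by the sum of its coordinates. -/
noncomputable def normalize {ι : Type*} [Fintype ι] (y : ι → ℝ) : ι → ℝ := fun i => y i / ∑ l, y l

@[fun_prop]
theorem measurable_normalize {ι : Type*} [Fintype ι] :
    Measurable (normalize : (ι → ℝ) → ι → ℝ) := by
  unfold normalize
  fun_prop

theorem normalize_smul {ι : Type*} [Fintype ι] {s : ℝ} (hs : s ≠ 0) {y : ι → ℝ}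
    (hy : ∑ i, y i = 1) : normalize (fun i => s * y i) = y := by
  ext i
  rw [normalize, ← Finset.mul_sum, hy]
  field_simp

theorem fiberSum_normalize {ι κ : Type*} [Fintype ι] [Fintype κ] [DecidableEq κ] (f : ι → κ)
    (y : ι → ℝ) : fiberSum f (normalize y) = normalize (fiberSum f y) := by
  ext i
  rw [normalize, sum_fiberSum, fiberSum, fiberSum, Finset.sum_div]
  rfl

theorem lintegral_comp_smul_pi {J : Type*} [Fintype J] {s : ℝ} (hs : 0 < s)
    {H : (J → ℝ) → ℝ≥0∞} (hH : Measurable H) :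
    ∫⁻ x, H x = ENNReal.ofReal (s ^ Fintype.card J) * ∫⁻ x : J → ℝ, H fun j => s * x j := by
  have h := Measure.map_addHaar_smul (volume : Measure (J → ℝ)) hs.ne'
  have h2 : (∫⁻ x : J → ℝ, H fun j => s * x j) = ∫⁻ x, H x ∂(volume.map fun x : J → ℝ => s • x) := by
    rw [lintegral_map hH (by fun_prop)]
    rfl
  rw [h2, h, lintegral_smul_measure, smul_eq_mul, ← mul_assoc, ← ENNReal.ofReal_mul (by positivity),
    Module.finrank_fintype_fun_eq_card, abs_of_pos (by positivity), mul_inv_cancel₀ (by positivity),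
    ENNReal.ofReal_one, one_mul]

/-- The Dirichlet density with parameters `c_t + 1`, as a function of all coordinates. -/
noncomputable def fullDirichletDensity {T : Type*} [Fintype T] (c : T → ℕ) (z : T → ℝ) : ℝ≥0∞ :=
  open Classical in
  if ∀ t, 0 < z t then
    ENNReal.ofReal (((∑ t, (c t + 1) - 1)! : ℝ) / (∏ t, ((c t)! : ℝ)) * ∏ t, z t ^ c t) else 0

/-- In the coordinates `y = s z` with `∑ z = 1`, the exponentials give `e^{-s}` and the powers of
`s` separate. The factor `s ^ (card T - 1)` is the Jacobian of scaling the free coordinates. The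
factorization expresses the independence of the total and the normalized vector. -/
theorem prod_erlangPDF_smul {T : Type*} [Fintype T] [Nonempty T] (c : T → ℕ) (z : T → ℝ)
    (hz : ∑ t, z t = 1) {s : ℝ} (hs : 0 < s) :
    ENNReal.ofReal (s ^ (Fintype.card T - 1)) * ∏ t, erlangPDF (c t) (s * z t) =
      erlangPDF (∑ t, (c t + 1) - 1) s * fullDirichletDensity c z := by
  classical
  by_cases h : ∀ t, 0 < z t
  · have h1 : ∀ t, erlangPDF (c t) (s * z t) = ENNReal.ofReal
        ((s * z t) ^ c t * Real.exp (-(s * z t)) / ((c t)! : ℝ)) := fun t =>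
      if_pos (mul_pos hs (h t))
    have hexp : ∏ t, Real.exp (-(s * z t)) = Real.exp (-s) := by
      rw [← Real.exp_sum, Finset.sum_neg_distrib, ← Finset.mul_sum, hz, mul_one]
    have hcard : 0 < Fintype.card T := Fintype.card_pos
    have hsum : ∑ t, (c t + 1) - 1 = (Fintype.card T - 1) + ∑ t, c t := by
      rw [Finset.sum_add_distrib]
      simp
      omega
    rw [Finset.prod_congr rfl fun t _ => h1 t, ← ENNReal.ofReal_prod_of_nonneg,
      ← ENNReal.ofReal_mul (by positivity), erlangPDF, if_pos hs, fullDirichletDensity, if_pos h,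
      ← ENNReal.ofReal_mul (by positivity)]
    · congr 1
      rw [Finset.prod_div_distrib, Finset.prod_mul_distrib, hexp]
      simp_rw [mul_pow]
      rw [Finset.prod_mul_distrib, Finset.prod_pow_eq_pow_sum, hsum, pow_add]
      have : ((Fintype.card T - 1 + ∑ t, c t)! : ℝ) ≠ 0 := by positivity
      field_simp
    · intro t _
      have := h t
      positivity
  · rw [fullDirichletDensity, if_neg h, mul_zero]
    push Not at h
    obtain ⟨t, ht⟩ := h
    rw [Finset.prod_eq_zero (Finset.mem_univ t), mul_zero]
    exact if_neg (not_lt.2 (mul_nonpos_of_nonneg_of_nonpos hs.le ht))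

@[fun_prop]
theorem measurable_fullDirichletDensity {T : Type*} [Fintype T] (c : T → ℕ) :
    Measurable (fullDirichletDensity c) := by
  unfold fullDirichletDensity
  refine Measurable.ite ?_ (by fun_prop) measurable_const
  have : {z : T → ℝ | ∀ t, 0 < z t} = ⋂ t, {z | 0 < z t} := by ext; simp
  rw [this]
  exact MeasurableSet.iInter fun t => measurableSet_lt measurable_const (measurable_pi_apply t)

/-- A point of the affine hyperplane `∑ z = 1`, given by all its coordinates but one. -/
noncomputable def completePoint {J : Type*} [Fintype J] (x : J → ℝ) (t : Option J) : ℝ :=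
  t.elim (1 - ∑ j, x j) x

@[fun_prop]
theorem measurable_completePoint {J : Type*} [Fintype J] :
    Measurable (completePoint : (J → ℝ) → Option J → ℝ) := by
  refine measurable_pi_lambda _ fun t => ?_
  cases t <;> (simp only [completePoint, Option.elim]; fun_prop)

theorem sum_completePoint {J : Type*} [Fintype J] (x : J → ℝ) : ∑ t, completePoint x t = 1 := by
  simp [completePoint, Fintype.sum_option]

/-- Normalized independent gamma variables have a Dirichlet density. -/
theorem lintegral_normalize_pi_erlang {J : Type*} [Fintype J] (c : Option J → ℕ)
    {G : (Option J → ℝ) → ℝ≥0∞} (hG : Measurable G) :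
    ∫⁻ y, G (normalize y) ∂(Measure.pi fun t => erlang (c t + 1)) =
      ∫⁻ x : J → ℝ, fullDirichletDensity c (completePoint x) * G (completePoint x) := by
  have hP : ∀ t, IsProbabilityMeasure (volume.withDensity (erlangPDF (c t))) := fun t =>
    isProbabilityMeasure_erlang (c t + 1)
  have hD : Measurable fun y : Option J → ℝ => ∏ t, erlangPDF (c t) (y t) :=
    Finset.measurable_prod _ fun t _ => (measurable_erlangPDF _).comp (measurable_pi_apply t)
  have hpi : (Measure.pi fun t => erlang (c t + 1)) =
      (Measure.pi fun _ => volume).withDensity fun y : Option J → ℝ =>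
        ∏ t, erlangPDF (c t) (y t) :=
    pi_withDensity (fun t => erlangPDF (c t)) fun t => measurable_erlangPDF _
  set F : (Option J → ℝ) → ℝ≥0∞ := fun y => (∏ t, erlangPDF (c t) (y t)) * G (normalize y) with hFd
  have hF : Measurable F := hD.mul (hG.comp measurable_normalize)
  have hmk : Measurable fun p : (J → ℝ) × ℝ =>
      (fun t : Option J => t.elim (p.2 - ∑ j, p.1 j) p.1 : Option J → ℝ) := by
    refine measurable_pi_lambda _ fun t => ?_
    cases t <;> (simp only [Option.elim]; fun_prop)
  -- Translating the coordinate `none` by the sum of the others makes the outer variable `s` the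
  -- total.
  have h1 : ∫⁻ y, G (normalize y) ∂(Measure.pi fun t => erlang (c t + 1)) =
      ∫⁻ s, ∫⁻ x : J → ℝ, F fun t => t.elim (s - ∑ j, x j) x := by
    rw [hpi]
    refine (lintegral_withDensity_eq_lintegral_mul _ hD (hG.comp measurable_normalize)).trans ?_
    change ∫⁻ y, F y ∂_ = _
    rw [lintegral_pi_option _ hF]
    refine Eq.trans (lintegral_congr fun x => ?_)
      (lintegral_lintegral_swap (f := fun (x : J → ℝ) s => F fun t => t.elim (s - ∑ j, x j) x)
        (hF.comp hmk).aemeasurable)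
    exact (lintegral_sub_right_eq_self (fun s => F fun t => t.elim s x) (∑ j, x j)).symm
  have h2 : ∀ s, ∫⁻ x : J → ℝ, F (fun t => t.elim (s - ∑ j, x j) x) =
      erlangPDF (∑ t, (c t + 1) - 1) s *
        ∫⁻ x : J → ℝ, fullDirichletDensity c (completePoint x) * G (completePoint x) := by
    intro s
    by_cases hs : 0 < s
    · have hm : Measurable fun x : J → ℝ =>
          F fun t => t.elim (s - ∑ j, s * x j) fun j => s * x j :=
        hF.comp (hmk.comp (by fun_prop : Measurable fun x : J → ℝ => (fun j => s * x j, s)))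
      rw [lintegral_comp_smul_pi hs (H := fun x => F (fun t => t.elim (s - ∑ j, x j) x))
        (hF.comp (hmk.comp (by fun_prop : Measurable fun x : J → ℝ => (x, s)))),
        ← lintegral_const_mul _ hm, ← lintegral_const_mul _ (by fun_prop)]
      · refine lintegral_congr fun x => ?_
        have h3 : (fun t : Option J => t.elim (s - ∑ j, s * x j) fun j => s * x j) =
            fun t => s * completePoint x t := by
          ext t
          cases t with
          | none => simp [completePoint, mul_sub, Finset.mul_sum]
          | some j => rfl
        have h4 := prod_erlangPDF_smul c (completePoint x) (sum_completePoint x) hs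
        rw [Fintype.card_option, Nat.add_sub_cancel] at h4
        rw [h3, hFd]
        simp only
        rw [normalize_smul hs.ne' (sum_completePoint x), ← mul_assoc, h4, mul_assoc]
    · rw [erlangPDF, if_neg hs, zero_mul]
      refine (lintegral_congr fun x => ?_).trans lintegral_zero
      -- For `s ≤ 0` the coordinates, which add up to `s`, cannot all be positive, so the product of
      -- densities vanishes.
      have h5 : ∃ t : Option J, ¬ 0 < t.elim (s - ∑ j, x j) x := by
        by_contra! h
        have := h none
        have h6 : 0 ≤ ∑ j, x j := Finset.sum_nonneg fun j _ => (h (some j)).le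
        simp only [Option.elim] at this
        linarith
      obtain ⟨t, ht⟩ := h5
      rw [hFd]
      simp only
      rw [Finset.prod_eq_zero (Finset.mem_univ t) (if_neg ht), zero_mul]
  rw [h1, lintegral_congr h2, lintegral_mul_const _ (measurable_erlangPDF _)]
  have h7 : ∫⁻ s, erlangPDF (∑ t, (c t + 1) - 1) s = 1 := by
    have := (isProbabilityMeasure_erlang (∑ t, (c t + 1) - 1 + 1)).measure_univ
    simpa [erlang] using this
  rw [h7, one_mul]

end Normalization

/-! ### Dirichlet laws with natural parameters, and aggregation. -/

section Dirichlet

variable {ι : Type*} [Fintype ι]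

/-- The support is coded as `Option` of the free indices, with `none` standing for `i₀`. The
`Fintype` instance is arbitrary so that it can match the one produced by unfolding the definitions.
-/
theorem sum_face_eq {S : Type*} [AddCommMonoid S] (a : ι → ℝ) (i₀ : ι)
    [Fintype {i : ι // 0 < a i ∧ i ≠ i₀}]
    (h0 : 0 < a i₀) (g : ι → S) :
    ∑ i with 0 < a i, g i =
      ∑ t : Option {i : ι // 0 < a i ∧ i ≠ i₀}, g (t.elim i₀ Subtype.val) := by
  classical
  have h1 : Finset.univ.filter (fun i => 0 < a i) =
      insert i₀ (Finset.univ.filter fun i => 0 < a i ∧ i ≠ i₀) := by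
    ext i
    by_cases h : i = i₀
    · subst h; simp [h0]
    · simp [h]
  rw [h1, Finset.sum_insert (by simp), Fintype.sum_option]
  congr 1
  exact Finset.sum_subtype _ (by simp) g

theorem prod_face_eq {S : Type*} [CommMonoid S] (a : ι → ℝ) (i₀ : ι)
    [Fintype {i : ι // 0 < a i ∧ i ≠ i₀}]
    (h0 : 0 < a i₀) (g : ι → S) :
    ∏ i with 0 < a i, g i =
      ∏ t : Option {i : ι // 0 < a i ∧ i ≠ i₀}, g (t.elim i₀ Subtype.val) :=
  sum_face_eq (S := Additive S) a i₀ h0 g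

theorem simplexPoint_elim (a : ι → ℝ) (i₀ : ι) [Fintype {i : ι // 0 < a i ∧ i ≠ i₀}]
    (x : {i : ι // 0 < a i ∧ i ≠ i₀} → ℝ)
    (t : Option {i : ι // 0 < a i ∧ i ≠ i₀}) :
    simplexPoint a i₀ x (t.elim i₀ Subtype.val) = completePoint x t := by
  cases t with
  | none =>
    have h : simplexPoint a i₀ x i₀ = 1 - ∑ j, x j := by
      rw [simplexPoint, dif_neg (fun h => h.2 rfl), if_pos rfl]
      congr!
    exact h
  | some j => simp [simplexPoint, completePoint, j.2]

/-- Extension by zero off the support is a fibre sum along the inclusion of the support, so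
vanishing parameters fit into the same aggregation formalism. -/
theorem fiberSum_elim [DecidableEq ι] {S : Type*} [AddCommMonoid S] (a : ι → ℝ) (i₀ : ι)
    [Fintype {i : ι // 0 < a i ∧ i ≠ i₀}]
    (h0 : 0 < a i₀) (g : ι → S) (hg : ∀ i, ¬ 0 < a i → g i = 0) :
    fiberSum (fun t : Option {i : ι // 0 < a i ∧ i ≠ i₀} => t.elim i₀ Subtype.val)
      (fun t => g (t.elim i₀ Subtype.val)) = g := by
  ext i
  rw [fiberSum, Finset.sum_filter]
  rw [← sum_face_eq a i₀ h0 fun l => if l = i then g l else 0, Finset.sum_ite_eq']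
  by_cases hi : 0 < a i
  · simp [hi]
  · simp [hi, hg i hi]

theorem dirichletDensity_eq (b : ι → ℕ) (i₀ : ι) (h0 : 0 < b i₀)
    [Fintype {i : ι // 0 < (b i : ℝ) ∧ i ≠ i₀}]
    (x : {i : ι // 0 < (b i : ℝ) ∧ i ≠ i₀} → ℝ) :
    dirichletDensity (fun i => (b i : ℝ)) i₀ x =
      fullDirichletDensity (fun t => b (t.elim i₀ Subtype.val) - 1) (completePoint x) := by
  classical
  have h0' : 0 < (b i₀ : ℝ) := by exact_mod_cast h0
  have hpos : ∀ t : Option {i : ι // 0 < (b i : ℝ) ∧ i ≠ i₀}, 0 < b (t.elim i₀ Subtype.val) := by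
    intro t
    cases t with
    | none => exact h0
    | some j => exact_mod_cast j.2.1
  have hc : ∀ t : Option {i : ι // 0 < (b i : ℝ) ∧ i ≠ i₀},
      b (t.elim i₀ Subtype.val) - 1 + 1 = b (t.elim i₀ Subtype.val) := fun t =>
    Nat.sub_add_cancel (hpos t)
  have hiff : (∀ i, 0 < (b i : ℝ) → 0 < simplexPoint (fun i => (b i : ℝ)) i₀ x i) ↔
      ∀ t, 0 < completePoint x t := by
    constructor
    · intro h t
      rw [← simplexPoint_elim]
      exact h _ (by exact_mod_cast hpos t)
    · intro h i hi
      by_cases h' : i = i₀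
      · subst h'
        exact (simplexPoint_elim (fun i => (b i : ℝ)) i x none) ▸ h none
      · exact (simplexPoint_elim (fun i => (b i : ℝ)) i₀ x (some ⟨i, hi, h'⟩)) ▸ h _
  unfold dirichletDensity fullDirichletDensity
  by_cases h : ∀ t, 0 < completePoint x t
  · rw [if_pos h, if_pos (hiff.2 h), sum_face_eq _ i₀ h0', prod_face_eq _ i₀ h0',
      prod_face_eq _ i₀ h0']
    simp_rw [hc]
    have hG : ∀ n : ℕ, 0 < n → Real.Gamma n = ((n - 1)! : ℝ) := by
      intro n hn
      obtain ⟨m, rfl⟩ := Nat.exists_eq_succ_of_ne_zero hn.ne'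
      simpa using Real.Gamma_nat_eq_factorial m
    congr 3
    · rw [← Nat.cast_sum, hG]
      exact Finset.sum_pos (fun t _ => hpos t) ⟨none, Finset.mem_univ _⟩
    · exact Finset.prod_congr rfl fun t _ => hG _ (hpos t)
    · refine funext fun t => ?_
      rw [simplexPoint_elim, ← Real.rpow_natCast, Nat.cast_sub (hpos t)]
      simp
  · rw [if_neg h, if_neg (fun h' => h (hiff.1 h'))]

theorem simplexPoint_eq_fiberSum [DecidableEq ι] (a : ι → ℝ) (i₀ : ι) (h0 : 0 < a i₀)
    [Fintype {i : ι // 0 < a i ∧ i ≠ i₀}]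
    (x : {i : ι // 0 < a i ∧ i ≠ i₀} → ℝ) :
    simplexPoint a i₀ x = fiberSum
      (fun t : Option {i : ι // 0 < a i ∧ i ≠ i₀} => t.elim i₀ Subtype.val) (completePoint x) := by
  have h := fiberSum_elim a i₀ h0 (simplexPoint a i₀ x) ?_
  · simp_rw [simplexPoint_elim] at h
    exact h.symm
  · intro i hi
    have : i ≠ i₀ := by rintro rfl; exact hi h0
    simp [simplexPoint, hi, this]

/-- The Dirichlet distribution with natural parameters as the law of normalized independent gamma
variables. -/
theorem map_simplexPoint_eq (b : ι → ℕ) (i₀ : ι) (h0 : 0 < b i₀)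
    [Fintype {i : ι // 0 < (b i : ℝ) ∧ i ≠ i₀}] :
    (volume.withDensity (dirichletDensity (fun i => (b i : ℝ)) i₀)).map
      (simplexPoint (fun i => (b i : ℝ)) i₀) =
    (Measure.pi fun i => erlang (b i)).map normalize := by
  classical
  have h0' : 0 < (b i₀ : ℝ) := by exact_mod_cast h0
  set e : Option {i : ι // 0 < (b i : ℝ) ∧ i ≠ i₀} → ι := fun t => t.elim i₀ Subtype.val
  have hpos : ∀ t, 0 < b (e t) := by
    intro t
    cases t with
    | none => exact h0
    | some j => exact_mod_cast j.2.1
  have hsp : simplexPoint (fun i => (b i : ℝ)) i₀ = fun x : {i : ι // 0 < (b i : ℝ) ∧ i ≠ i₀} → ℝ => fiberSum e (completePoint x) :=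
    funext fun x => simplexPoint_eq_fiberSum _ i₀ h0' x
  have hfs : fiberSum e (fun t => b (e t)) = b :=
    fiberSum_elim (fun i => (b i : ℝ)) i₀ h0' b fun i hi => by
      have : ¬ 0 < b i := fun h => hi (by exact_mod_cast h)
      omega
  have hd : dirichletDensity (fun i => (b i : ℝ)) i₀ = fun x : {i : ι // 0 < (b i : ℝ) ∧ i ≠ i₀} → ℝ =>
      fullDirichletDensity (fun t => b (e t) - 1) (completePoint x) :=
    funext fun x => dirichletDensity_eq b i₀ h0 x
  -- Indices with `b i = 0` have empty fibre and receive `erlang 0`, the point mass at zero. Thus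
  -- the gamma variables on the support push forward to the full product.
  have hpi := map_fiberSum_pi_erlang e fun t => b (e t)
  rw [hfs] at hpi
  refine Measure.ext_of_lintegral _ fun g hg => ?_
  have hm : Measurable fun x : {i : ι // 0 < (b i : ℝ) ∧ i ≠ i₀} → ℝ => fiberSum e (completePoint x) := by fun_prop
  rw [hsp, hd, ← hpi, lintegral_map hg hm, lintegral_map hg measurable_normalize]
  refine (lintegral_withDensity_eq_lintegral_mul _ (by fun_prop) (hg.comp hm)).trans ?_
  refine Eq.trans ?_
    (lintegral_map (hg.comp measurable_normalize) (measurable_fiberSum e)).symm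
  simp_rw [Function.comp_apply, ← fiberSum_normalize]
  have h := lintegral_normalize_pi_erlang (fun t => b (e t) - 1) (hg.comp (measurable_fiberSum e))
  have hc : ∀ t, b (e t) - 1 + 1 = b (e t) := fun t => Nat.sub_add_cancel (hpos t)
  simp_rw [hc] at h
  exact h.symm

/-- The right side does not involve the distinguished index, so any `i₀` in the support would do;
here it is the least one, as in the definition. -/
theorem dirichlet_natCast_eq {n : ℕ} (b : Fin n → ℕ) (hb : 0 < ∑ i, b i) :
    dirichlet (fun i => (b i : ℝ)) = (Measure.pi fun i => erlang (b i)).map normalize := by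
  classical
  obtain ⟨i, -, hi⟩ := Finset.exists_ne_zero_of_sum_ne_zero hb.ne'
  have h : (Finset.univ.filter fun i => 0 < (b i : ℝ)).Nonempty :=
    ⟨i, by simpa using Nat.pos_of_ne_zero hi⟩
  have hmin := Finset.min'_mem _ h
  have h0 : 0 < b ((Finset.univ.filter fun i => 0 < (b i : ℝ)).min' h) := by
    simpa using hmin
  rw [← map_simplexPoint_eq b _ h0]
  unfold dirichlet
  rw [dif_pos h]

variable {n : ℕ} (b : Fin n → ℕ) (hb : 0 < ∑ i, b i)
include hb

theorem isProbabilityMeasure_dirichlet :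
    IsProbabilityMeasure (dirichlet fun i => (b i : ℝ)) := by
  rw [dirichlet_natCast_eq b hb]
  exact Measure.isProbabilityMeasure_map (by fun_prop)

theorem ae_dirichlet : ∀ᵐ w ∂(dirichlet fun i => (b i : ℝ)), (∀ i, 0 ≤ w i) ∧ ∑ i, w i = 1 := by
  rw [dirichlet_natCast_eq b hb]
  have hm : MeasurableSet {w : Fin n → ℝ | (∀ i, 0 ≤ w i) ∧ ∑ i, w i = 1} := by
    refine MeasurableSet.inter ?_ (measurableSet_eq_fun (by fun_prop) measurable_const)
    have : {w : Fin n → ℝ | ∀ i, 0 ≤ w i} = ⋂ i, {w | 0 ≤ w i} := by ext; simp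
    change MeasurableSet {w : Fin n → ℝ | ∀ i, 0 ≤ w i}
    rw [this]
    exact MeasurableSet.iInter fun i => measurableSet_le measurable_const (measurable_pi_apply i)
  refine (ae_map_iff (by fun_prop) hm).2 ?_
  obtain ⟨i, -, hi⟩ := Finset.exists_ne_zero_of_sum_ne_zero hb.ne'
  have h1 : ∀ᵐ y ∂(Measure.pi fun i => erlang (b i)), ∀ i, 0 ≤ y i :=
    ae_all_iff.2 fun l =>
      (Measure.tendsto_eval_ae_ae (μ := fun i => erlang (b i)) (i := l)).eventually
        (ae_erlang_nonneg (b l))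
  have h2 : ∀ᵐ y ∂(Measure.pi fun i => erlang (b i)), 0 < y i :=
    (Measure.tendsto_eval_ae_ae (μ := fun i => erlang (b i)) (i := i)).eventually
      (ae_erlang_pos (Nat.pos_of_ne_zero hi))
  filter_upwards [h1, h2] with y hy1 hy2
  have hs : 0 < ∑ l, y l := Finset.sum_pos' (fun l _ => hy1 l) ⟨i, Finset.mem_univ i, hy2⟩
  refine ⟨fun l => div_nonneg (hy1 l) hs.le, ?_⟩
  simp only [normalize]
  rw [← Finset.sum_div, div_self hs.ne']

/-- Aggregation property of the Dirichlet distribution. -/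
theorem map_fiberSum_dirichlet {l : ℕ} (f : Fin n → Fin l) :
    (dirichlet fun i => (b i : ℝ)).map (fiberSum f) = dirichlet fun i => ((fiberSum f b i : ℕ) : ℝ) := by
  -- Fibre sums preserve the total and hence commute with `normalize`, which reduces the claim to
  -- additivity of gamma variables.
  rw [dirichlet_natCast_eq b hb, dirichlet_natCast_eq _ (by rwa [sum_fiberSum]),
    ← map_fiberSum_pi_erlang, Measure.map_map (by fun_prop) (by fun_prop),
    Measure.map_map (by fun_prop) (by fun_prop)]
  congr 1
  exact funext fun y => fiberSum_normalize f y

end Dirichlet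

/-! ### The Ewens distribution as a finite sum of point masses. -/

section Ewens

theorem ewensCoeff_pos {k : ℕ} (m : Fin k → ℕ) : 0 < ewensCoeff m := by
  unfold ewensCoeff
  positivity

theorem ewens_eq_sum (k : ℕ) (a : ℝ) :
    ewens k a = ∑ m ∈ ofWeight k k,
      ENNReal.ofReal (ewensCoeff m * a ^ (∑ j, m j) / poch a k) • Measure.dirac m := by
  ext s hs
  rw [ewens, Measure.sum_apply _ hs, Measure.finsetSum_apply]
  change ∑' m : {m : Fin k → ℕ | ∑ j : Fin k, ((j : ℕ) + 1) * m j = k},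
    (ENNReal.ofReal (ewensCoeff m.1 * a ^ (∑ j, m.1 j) / poch a k) • Measure.dirac m.1) s = _
  rw [tsum_subtype {m : Fin k → ℕ | ∑ j : Fin k, ((j : ℕ) + 1) * m j = k} fun m =>
    (ENNReal.ofReal (ewensCoeff m * a ^ (∑ j, m j) / poch a k) • Measure.dirac m) s,
    tsum_eq_sum (s := ofWeight k k)]
  · refine Finset.sum_congr rfl fun m hm => ?_
    rw [Set.indicator_of_mem]
    exact mem_ofWeight.1 hm
  · intro m hm
    rw [Set.indicator_of_notMem]
    exact fun h => hm (mem_ofWeight.2 h)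

theorem ewens_apply {k : ℕ} {a : ℝ} {m : Fin k → ℕ} (hm : m ∈ ofWeight k k) :
    ewens k a {m} = ENNReal.ofReal (ewensCoeff m * a ^ (∑ j, m j) / poch a k) := by
  rw [ewens_eq_sum, Measure.finsetSum_apply, Finset.sum_eq_single m]
  · simp
  · intro m' _ hne
    simp [hne]
  · exact fun h => absurd hm h

theorem ae_ewens (k : ℕ) (a : ℝ) : ∀ᵐ m ∂(ewens k a), m ∈ ofWeight k k := by
  rw [ae_iff, ewens_eq_sum, Measure.finsetSum_apply]
  refine Finset.sum_eq_zero fun m hm => ?_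
  have : m ∉ {m | m ∉ ofWeight k k} := fun h => h hm
  rw [Measure.smul_apply, Measure.dirac_apply, Set.indicator_of_notMem this, smul_zero]

theorem sum_ewens_weight (k : ℕ) {a : ℝ} (ha : 0 < a) :
    ∑ m ∈ ofWeight k k, ENNReal.ofReal (ewensCoeff m * a ^ (∑ j, m j) / poch a k) = 1 := by
  have hp := poch_pos ha k
  rw [← ENNReal.ofReal_sum_of_nonneg, ← Finset.sum_div, sum_ewensCoeff, div_self hp.ne',
    ENNReal.ofReal_one]
  intro m _
  have := ewensCoeff_pos m
  positivity

end Ewens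

/-! ### From coloured partitions to the quasi Bernoulli weights. -/

section Mixture

/-- The case `b = 0`, where the measure is the default `0`, is included because `sum_ewens_mixture`
asks for finiteness at every `b`. -/
theorem dirichlet_natCast_ne_top {n : ℕ} (b : Fin n → ℕ) (s : Set (Fin n → ℝ)) :
    dirichlet (fun i => (b i : ℝ)) s ≠ ∞ := by
  by_cases hb : 0 < ∑ i, b i
  · have := isProbabilityMeasure_dirichlet b hb
    exact measure_ne_top _ _
  · have h : ¬ (Finset.univ.filter fun i => 0 < (b i : ℝ)).Nonempty := by
      rintro ⟨i, hi⟩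
      refine hb (lt_of_lt_of_le ?_ (Finset.single_le_sum (fun _ _ => Nat.zero_le _)
        (Finset.mem_univ i)))
      simpa using hi
    unfold dirichlet
    rw [dif_neg h]
    simp

/-- A mixture over coloured Ewens partitions is a mixture over compositions. -/
theorem sum_ewens_mixture {n : ℕ} (k : ℕ) (a : Fin n → ℝ) (ha : ∀ i, 0 ≤ a i)
    (hpos : 0 < ∑ i, a i) (Ψ : (Fin n → ℕ) → ℝ≥0∞) (hΨ : ∀ b, Ψ b ≠ ∞) :
    ∑ m ∈ ofWeight k k,
      ENNReal.ofReal (ewensCoeff m * (∑ i, a i) ^ (∑ j, m j) / poch (∑ i, a i) k) *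
        ∑ f : Fin (numParts m) → Fin n, (∏ t, ENNReal.ofReal (a (f t) / ∑ i, a i)) *
          Ψ (fiberSum f fun t => part m t) =
    ∑ b ∈ Finset.piAntidiag (Finset.univ : Finset (Fin n)) k,
      ENNReal.ofReal ((k ! : ℝ) / poch (∑ i, a i) k * ∏ i, poch (a i) (b i) / ((b i)! : ℝ)) *
        Ψ b := by
  set A := ∑ i, a i
  have hp := poch_pos hpos k
  have hq : ∀ i n, 0 ≤ poch (a i) n := fun i n => poch_nonneg (ha i) n
  obtain ⟨Φ, hΦ0, hΦ⟩ : ∃ Φ : (Fin n → ℕ) → ℝ, (∀ b, 0 ≤ Φ b) ∧ ∀ b, Ψ b = ENNReal.ofReal (Φ b) :=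
    ⟨fun b => (Ψ b).toReal, fun _ => ENNReal.toReal_nonneg,
      fun b => (ENNReal.ofReal_toReal (hΨ b)).symm⟩
  have hl : ∀ m ∈ ofWeight k k,
      ENNReal.ofReal (ewensCoeff m * A ^ (∑ j, m j) / poch A k) *
        ∑ f : Fin (numParts m) → Fin n, (∏ t, ENNReal.ofReal (a (f t) / A)) *
          Ψ (fiberSum f fun t => part m t) =
      ENNReal.ofReal ((poch A k)⁻¹ * (ewensCoeff m * ∑ f : Fin (numParts m) → Fin n,
        (∏ t, a (f t)) * Φ (fiberSum f fun t => part m t))) := by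
    intro m _
    have hm := ewensCoeff_pos m
    have h1 : ∀ f : Fin (numParts m) → Fin n, (∏ t, ENNReal.ofReal (a (f t) / A)) *
          Ψ (fiberSum f fun t => part m t) =
        ENNReal.ofReal ((∏ t, a (f t) / A) * Φ (fiberSum f fun t => part m t)) := by
      intro f
      have h2 : ∀ t, 0 ≤ a (f t) / A := fun t => div_nonneg (ha _) hpos.le
      rw [hΦ, ← ENNReal.ofReal_prod_of_nonneg fun t _ => h2 t,
        ← ENNReal.ofReal_mul (Finset.prod_nonneg fun t _ => h2 t)]
    rw [Finset.sum_congr rfl fun f _ => h1 f, ← ENNReal.ofReal_sum_of_nonneg,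
      ← ENNReal.ofReal_mul (by positivity)]
    · congr 1
      -- The factor `A ^ (∑ j, m j)` of the Ewens weight cancels the normalization of the colour
      -- probabilities, one `A` per part.
      simp_rw [Finset.prod_div_distrib, Finset.prod_const, Finset.card_univ, Fintype.card_fin,
        numParts_eq, div_mul_eq_mul_div, ← Finset.sum_div]
      field_simp
    · intro f _
      exact mul_nonneg (Finset.prod_nonneg fun t _ => div_nonneg (ha _) hpos.le) (hΦ0 _)
  have hr : ∀ b ∈ Finset.piAntidiag (Finset.univ : Finset (Fin n)) k,
      ENNReal.ofReal ((k ! : ℝ) / poch A k * ∏ i, poch (a i) (b i) / ((b i)! : ℝ)) * Ψ b =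
      ENNReal.ofReal ((poch A k)⁻¹ *
        (((k ! : ℝ) * ∏ i, poch (a i) (b i) / ((b i)! : ℝ)) * Φ b)) := by
    intro b _
    have : 0 ≤ ∏ i, poch (a i) (b i) / ((b i)! : ℝ) :=
      Finset.prod_nonneg fun i _ => div_nonneg (hq _ _) (by positivity)
    rw [hΦ, ← ENNReal.ofReal_mul (by positivity)]
    congr 1
    ring
  rw [Finset.sum_congr rfl hl, Finset.sum_congr rfl hr, ← ENNReal.ofReal_sum_of_nonneg,
    ← ENNReal.ofReal_sum_of_nonneg, ← Finset.mul_sum, ← Finset.mul_sum, sum_ewens_coloring]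
  · intro b _
    have : 0 ≤ ∏ i, poch (a i) (b i) / ((b i)! : ℝ) :=
      Finset.prod_nonneg fun i _ => div_nonneg (hq _ _) (by positivity)
    have := hΦ0 b
    positivity
  · intro m _
    have hm := ewensCoeff_pos m
    refine mul_nonneg (inv_nonneg.2 hp.le) (mul_nonneg hm.le (Finset.sum_nonneg fun f _ => ?_))
    exact mul_nonneg (Finset.prod_nonneg fun t _ => ha _) (hΦ0 _)

end Mixture

/-! ### Cell masses of a discrete measure with random atoms. -/

section Coloring

variable {Ω : Type*} [MeasurableSpace Ω]

/-- The masses of the cells `A i` under the discrete measure with weights `w` at the points `x`. -/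
noncomputable def cellMass {s n : ℕ} (A : Fin n → Set Ω) (p : (Fin s → Ω) × (Fin s → ℝ))
    (i : Fin n) : ℝ := ∑ t, (A i).indicator (fun _ => p.2 t) (p.1 t)

theorem measurable_cellMass {s n : ℕ} {A : Fin n → Set Ω} (hA : ∀ i, MeasurableSet (A i)) :
    Measurable (cellMass A : (Fin s → Ω) × (Fin s → ℝ) → Fin n → ℝ) := by
  classical
  refine measurable_pi_lambda _ fun i => Finset.measurable_sum _ fun t _ => ?_
  simp only [Set.indicator_apply]
  refine Measurable.ite ?_ (by fun_prop) measurable_const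
  exact ((measurable_pi_apply t).comp measurable_fst) (hA i)

/-- Once the points are fixed, the cell masses depend on them only through the colouring `t ↦ col (x
t)`, and are the fibre sums of the weights. Independence of the points makes the probability of a
colouring a product. -/
theorem cellMass_prod_apply {s n : ℕ} {A : Fin n → Set Ω} (hA : ∀ i, MeasurableSet (A i))
    (hdisj : Pairwise fun i j => Disjoint (A i) (A j)) (hcover : ⋃ i, A i = Set.univ)
    (ρ : Measure Ω) [IsProbabilityMeasure ρ] (D : Measure (Fin s → ℝ)) [IsProbabilityMeasure D]
    {S : Set (Fin n → ℝ)} (hS : MeasurableSet S) :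
    ((Measure.pi fun _ : Fin s => ρ).prod D) (cellMass A ⁻¹' S) =
      ∑ f : Fin s → Fin n, (∏ t, ρ (A (f t))) * D.map (fiberSum f) S := by
  classical
  have hex : ∀ x, ∃ i, x ∈ A i := fun x => by
    have : x ∈ ⋃ i, A i := by rw [hcover]; trivial
    exact Set.mem_iUnion.1 this
  choose col hcol using hex
  have hiff : ∀ x i, x ∈ A i ↔ col x = i := by
    intro x i
    refine ⟨fun h => ?_, fun h => h ▸ hcol x⟩
    by_contra hne
    exact Set.disjoint_left.1 (hdisj hne) (hcol x) h
  have hcolm : Measurable col := by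
    refine measurable_to_countable' fun i => ?_
    have : col ⁻¹' {i} = A i := by ext x; simp [hiff]
    rw [this]
    exact hA i
  have hcm : Measurable fun (x : Fin s → Ω) t => col (x t) :=
    measurable_pi_lambda _ fun t => hcolm.comp (measurable_pi_apply t)
  rw [Measure.prod_apply (measurable_cellMass hA hS)]
  have h1 : ∀ x : Fin s → Ω, D (Prod.mk x ⁻¹' (cellMass A ⁻¹' S)) =
      (fun f : Fin s → Fin n => D.map (fiberSum f) S) fun t => col (x t) := by
    intro x
    simp only
    rw [Measure.map_apply (measurable_fiberSum _) hS]
    congr 1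
    ext w
    have : cellMass A (x, w) = fiberSum (fun t => col (x t)) w := by
      ext i
      rw [cellMass, fiberSum, Finset.sum_filter]
      refine Finset.sum_congr rfl fun t _ => ?_
      simp [Set.indicator_apply, hiff]
    simp only [Set.mem_preimage, this]
  rw [lintegral_congr h1, ← lintegral_map (f := fun f : Fin s → Fin n => D.map (fiberSum f) S)
    (measurable_of_countable _) hcm, lintegral_fintype]
  refine Finset.sum_congr rfl fun f _ => ?_
  rw [mul_comm, Measure.map_apply hcm (measurableSet_singleton _)]
  congr 1
  have : (fun (x : Fin s → Ω) t => col (x t)) ⁻¹' {f} = Set.univ.pi fun t => A (f t) := by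
    ext x
    simp [Set.mem_pi, hiff, funext_iff]
  rw [this, Measure.pi_pi]

end Coloring

/-! ### The law of the random measure. -/

section Selection

variable {Ω Θ : Type*} [MeasurableSpace Ω] [MeasurableSpace Θ]

theorem isProbabilityMeasure_dirichlet_part {k : ℕ} {m : Fin k → ℕ} (h : 0 < weight m) :
    IsProbabilityMeasure (dirichlet fun t : Fin (numParts m) => (part m t : ℝ)) :=
  isProbabilityMeasure_dirichlet (fun t : Fin (numParts m) => part m t) (by rwa [sum_part])

/-- Countably many fibres cover the space. On a non-null fibre, conditioning is restriction up to a
nonzero scalar; null fibres do not matter. -/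
theorem ae_of_ae_cond {κ : Type*} [Countable κ] {μ : Measure Θ} [IsFiniteMeasure μ] {M : Θ → κ}
    {p : Θ → Prop}
    (h : ∀ m, μ (M ⁻¹' {m}) ≠ 0 → ∀ᵐ θ ∂(cond μ (M ⁻¹' {m})), p θ) : ∀ᵐ θ ∂μ, p θ := by
  have hU : ⋃ m, M ⁻¹' {m} = Set.univ := by ext; simp
  rw [← Measure.restrict_univ (μ := μ), ← hU, ae_restrict_iUnion_iff]
  intro m
  by_cases h0 : μ (M ⁻¹' {m}) = 0
  · rw [Measure.restrict_eq_zero.2 h0]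
    simp
  · have := h m h0
    rw [ProbabilityTheory.cond] at this
    exact (Measure.ae_ennreal_smul_measure_iff (ENNReal.inv_ne_zero.2 (measure_ne_top _ _))).1 this

variable {k : ℕ} {α : Measure Ω} {μ : Measure Θ} {M : Θ → Fin k → ℕ} {X : ℕ → Θ → Ω}
  {W : ℕ → Θ → ℝ}

theorem measurable_randomMeasure (hM : Measurable M) (hX : ∀ t, Measurable (X t))
    (hW : ∀ t, Measurable (W t)) : Measurable (randomMeasure M X W) := by
  refine Measure.measurable_of_measurable_coe _ fun s hs => ?_
  -- The random number of terms becomes a separate variable in the countable space `ℕ`, so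
  -- measurability is checked for each fixed number.
  have h : ∀ θ, randomMeasure M X W θ s = (fun p : ℕ × Θ => ∑ t ∈ Finset.range p.1,
      ENNReal.ofReal (W t p.2) * s.indicator 1 (X t p.2)) (numParts (M θ), θ) := by
    intro θ
    simp [randomMeasure, Measure.finsetSum_apply, Measure.dirac_apply' _ hs]
  simp_rw [h]
  have hm : Measurable fun p : ℕ × Θ => ∑ t ∈ Finset.range p.1,
      ENNReal.ofReal (W t p.2) * s.indicator 1 (X t p.2) := by
    refine measurable_from_prod_countable_right fun N => ?_
    change Measurable fun y => ∑ t ∈ Finset.range N, ENNReal.ofReal (W t y) * s.indicator 1 (X t y)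
    refine Finset.measurable_sum _ fun t _ => Measurable.mul (hW t).ennreal_ofReal ?_
    exact (measurable_one.indicator hs).comp (hX t)
  exact hm.comp (((measurable_of_countable numParts).comp hM).prodMk measurable_id)

theorem IsEwensSelection.mem_ofWeight (h : IsEwensSelection k α μ M X W) {m : Fin k → ℕ}
    (hm : μ (M ⁻¹' {m}) ≠ 0) : m ∈ ofWeight k k := by
  by_contra hn
  refine hm ?_
  rw [← Measure.map_apply h.measurable_M (measurableSet_singleton m), h.law_M.map_eq]
  refine measure_mono_null ?_ (ae_iff.1 (ae_ewens k (α.real Set.univ)))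
  rintro _ rfl
  exact hn

theorem IsEwensSelection.ae_cond_simplex [IsFiniteMeasure μ] (h : IsEwensSelection k α μ M X W)
    (hk : 0 < k) {m : Fin k → ℕ} (hm : μ (M ⁻¹' {m}) ≠ 0) :
    ∀ᵐ θ ∂(cond μ (M ⁻¹' {m})), M θ = m ∧ (∀ t < numParts m, 0 ≤ W t θ) ∧
      ∑ t ∈ Finset.range (numParts m), W t θ = 1 := by
  have hw : 0 < ∑ t : Fin (numParts m), part m t := by
    rw [sum_part, QuasiBernoulli.mem_ofWeight.1 (h.mem_ofWeight hm)]
    exact hk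
  have h1 := ae_dirichlet (fun t : Fin (numParts m) => part m t) hw
  rw [← (h.law_W m hm).map_eq] at h1
  have h2 := ae_of_ae_map (h.law_W m hm).aemeasurable h1
  filter_upwards [ae_cond_mem (h.measurable_M (measurableSet_singleton m)), h2] with θ hθ hθ2
  refine ⟨hθ, fun t ht => hθ2.1 ⟨t, ht⟩, ?_⟩
  rw [Finset.sum_range]
  exact hθ2.2

theorem IsEwensSelection.ae_isProbabilityMeasure [IsFiniteMeasure μ]
    (h : IsEwensSelection k α μ M X W) (hk : 0 < k) :
    ∀ᵐ θ ∂μ, IsProbabilityMeasure (randomMeasure M X W θ) := by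
  refine ae_of_ae_cond (M := M) fun m hm => ?_
  filter_upwards [h.ae_cond_simplex hk hm] with θ hθ
  obtain ⟨rfl, h1, h2⟩ := hθ
  constructor
  simp only [randomMeasure, Measure.finsetSum_apply, Measure.smul_apply, measure_univ, smul_eq_mul,
    mul_one]
  rw [← ENNReal.ofReal_sum_of_nonneg fun t ht => h1 t (Finset.mem_range.1 ht), h2,
    ENNReal.ofReal_one]

variable [IsFiniteMeasure α]

theorem measureReal_univ_pos (hα : α ≠ 0) : 0 < α.real Set.univ := by
  rw [measureReal_def, ENNReal.toReal_pos_iff]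
  exact ⟨by simpa [pos_iff_ne_zero] using hα, measure_lt_top _ _⟩

theorem isProbabilityMeasure_normalized (hα : α ≠ 0) :
    IsProbabilityMeasure ((α Set.univ)⁻¹ • α) := by
  refine ⟨?_⟩
  rw [Measure.smul_apply, smul_eq_mul, ENNReal.inv_mul_cancel (by simpa using hα)
    (measure_ne_top _ _)]

/-- The law of the cell masses of the random measure, given the partition. -/
theorem IsEwensSelection.cond_cell_law [IsFiniteMeasure μ] (h : IsEwensSelection k α μ M X W)
    (hα : α ≠ 0) (hk : 0 < k) {n : ℕ} {A : Fin n → Set Ω} (hA : ∀ i, MeasurableSet (A i))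
    (hdisj : Pairwise fun i j => Disjoint (A i) (A j)) (hcover : ⋃ i, A i = Set.univ)
    {m : Fin k → ℕ} (hm : μ (M ⁻¹' {m}) ≠ 0) {S : Set (Fin n → ℝ)} (hS : MeasurableSet S) :
    cond μ (M ⁻¹' {m}) {θ | (fun i => (randomMeasure M X W θ).real (A i)) ∈ S} =
      ∑ f : Fin (numParts m) → Fin n,
        (∏ t, ENNReal.ofReal (α.real (A (f t)) / α.real Set.univ)) *
          dirichlet (fun i => ((fiberSum f (fun t => part m t) i : ℕ) : ℝ)) S := by
  have hwt : weight m = k := QuasiBernoulli.mem_ofWeight.1 (h.mem_ofWeight hm)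
  have hP : IsProbabilityMeasure (cond μ (M ⁻¹' {m})) := cond_isProbabilityMeasure hm
  have hρ := isProbabilityMeasure_normalized hα
  have hD := isProbabilityMeasure_dirichlet_part (m := m) (by omega)
  have hXm : Measurable fun θ (t : Fin (numParts m)) => X t θ :=
    measurable_pi_lambda _ fun t => h.measurable_X t
  have hWm : Measurable fun θ (t : Fin (numParts m)) => W t θ :=
    measurable_pi_lambda _ fun t => h.measurable_W t
  have hX : (cond μ (M ⁻¹' {m})).map (fun θ (t : Fin (numParts m)) => X t θ) =
      Measure.pi fun _ => (α Set.univ)⁻¹ • α := by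
    rw [iIndepFun.map_fun_eq_pi_map (f := fun t : Fin (numParts m) => X t)
      (fun t => (h.measurable_X t).aemeasurable) (h.indep_X m hm)]
    congr 1
    exact funext fun t => (h.law_X m hm t t.2).map_eq
  have hXW := (indepFun_iff_map_prod_eq_prod_map_map hXm.aemeasurable hWm.aemeasurable).1
    (h.indep_X_W m hm)
  rw [hX, (h.law_W m hm).map_eq] at hXW
  -- The equality is only almost sure: `ENNReal.ofReal` truncates negative weights, while `cellMass`
  -- uses the weights as they are.
  have hae : {θ | (fun i => (randomMeasure M X W θ).real (A i)) ∈ S} =ᵐ[cond μ (M ⁻¹' {m})]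
      (fun θ => ((fun t : Fin (numParts m) => X t θ), fun t : Fin (numParts m) => W t θ)) ⁻¹'
        (cellMass A ⁻¹' S) := by
    filter_upwards [h.ae_cond_simplex hk hm] with θ hθ
    obtain ⟨rfl, h1, -⟩ := hθ
    have : (fun i => (randomMeasure M X W θ).real (A i)) =
        cellMass A ((fun t : Fin (numParts (M θ)) => X t θ), fun t => W t θ) := by
      ext i
      rw [cellMass, measureReal_def, randomMeasure, Measure.finsetSum_apply,
        ENNReal.toReal_sum, Finset.sum_range]
      · refine Finset.sum_congr rfl fun t _ => ?_
        by_cases hx : X t θ ∈ A i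
        · simp [Measure.dirac_apply' _ (hA i), hx, ENNReal.toReal_ofReal (h1 t t.2)]
        · simp [Measure.dirac_apply' _ (hA i), hx]
      · intro t _
        exact ENNReal.mul_ne_top ENNReal.ofReal_ne_top (measure_ne_top _ _)
    change ((fun i => (randomMeasure M X W θ).real (A i)) ∈ S) = (cellMass A _ ∈ S)
    rw [this]
  rw [measure_congr hae, ← Measure.map_apply (hXm.prodMk hWm) (measurable_cellMass hA hS), hXW,
    cellMass_prod_apply hA hdisj hcover _ _ hS]
  refine Finset.sum_congr rfl fun f _ => ?_
  congr 1
  · refine Finset.prod_congr rfl fun t _ => ?_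
    rw [ENNReal.ofReal_div_of_pos (measureReal_univ_pos hα), measureReal_def, measureReal_def,
      ENNReal.ofReal_toReal (measure_ne_top _ _), ENNReal.ofReal_toReal (measure_ne_top _ _),
      Measure.smul_apply, smul_eq_mul, div_eq_mul_inv, mul_comm]
  · rw [map_fiberSum_dirichlet (fun t : Fin (numParts m) => part m t) (by rw [sum_part]; omega)]

theorem IsEwensSelection.quasiBernoulli_randomMeasure [IsProbabilityMeasure μ]
    (h : IsEwensSelection k α μ M X W) (hα : α ≠ 0) (hk : 0 < k) :
    IsQuasiBernoulliProcess k α μ (randomMeasure M X W) where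
  measurable := measurable_randomMeasure h.measurable_M h.measurable_X h.measurable_W
  isProbabilityMeasure := h.ae_isProbabilityMeasure hk
  law := by
    intro d A hA hdisj hcover
    have hPm := measurable_randomMeasure h.measurable_M h.measurable_X h.measurable_W
    have hFm : Measurable fun θ i => (randomMeasure M X W θ).real (A i) :=
      measurable_pi_lambda _ fun i => ((Measure.measurable_coe (hA i)).comp hPm).ennreal_toReal
    refine ⟨hFm.aemeasurable, ?_⟩
    have hsum : ∑ i, α.real (A i) = α.real Set.univ := by
      rw [← hcover, measureReal_iUnion_fintype hdisj hA]
    have hpos := measureReal_univ_pos hα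
    ext S hS
    rw [Measure.map_apply hFm hS]
    set E := (fun θ i => (randomMeasure M X W θ).real (A i)) ⁻¹' S
    have hmem : ∀ᵐ θ ∂μ, M θ ∈ ofWeight k k := by
      have := ae_ewens k (α.real Set.univ)
      rw [← h.law_M.map_eq] at this
      exact ae_of_ae_map h.measurable_M.aemeasurable this
    have h1 : μ E = ∑ m ∈ ofWeight k k, μ (M ⁻¹' {m} ∩ E) := by
      rw [← measure_biUnion_finset]
      · refine measure_congr ?_
        filter_upwards [hmem] with θ hθ
        refine propext ⟨fun hE => ?_, fun hE => ?_⟩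
        · exact Set.mem_biUnion (Finset.mem_coe.2 hθ) ⟨rfl, hE⟩
        · obtain ⟨m, -, hm⟩ := Set.mem_iUnion₂.1 hE
          exact hm.2
      · intro m _ m' _ hne
        refine Set.disjoint_left.2 fun θ h1 h2 => hne ?_
        exact h1.1.symm.trans h2.1
      · exact fun m _ => (h.measurable_M (measurableSet_singleton m)).inter (hFm hS)
    have h2 : ∀ m ∈ ofWeight k k, μ (M ⁻¹' {m} ∩ E) =
        ENNReal.ofReal (ewensCoeff m * (∑ i, α.real (A i)) ^ (∑ j, m j) /
          poch (∑ i, α.real (A i)) k) *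
        ∑ f : Fin (numParts m) → Fin (d + 1),
          (∏ t, ENNReal.ofReal (α.real (A (f t)) / ∑ i, α.real (A i))) *
          dirichlet (fun i => ((fiberSum f (fun t => part m t) i : ℕ) : ℝ)) S := by
      intro m hm
      have hw : μ (M ⁻¹' {m}) = ENNReal.ofReal (ewensCoeff m * (∑ i, α.real (A i)) ^ (∑ j, m j) /
          poch (∑ i, α.real (A i)) k) := by
        rw [← Measure.map_apply h.measurable_M (measurableSet_singleton m), h.law_M.map_eq,
          ewens_apply hm, hsum]
      rw [← cond_mul_eq_inter (h.measurable_M (measurableSet_singleton m)), mul_comm, ← hw, hsum]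
      -- Conditional laws are prescribed only on non-null events; otherwise both sides vanish.
      by_cases h0 : μ (M ⁻¹' {m}) = 0
      · rw [h0, zero_mul, zero_mul]
      · rw [← h.cond_cell_law hα hk hA hdisj hcover h0 hS]
        rfl
    rw [h1, Finset.sum_congr rfl h2, sum_ewens_mixture k (fun i => α.real (A i))
      (fun i => measureReal_nonneg) (by rw [hsum]; exact hpos)
      (fun b => dirichlet (fun i => (b i : ℝ)) S) fun b => dirichlet_natCast_ne_top b S,
      quasiBernoulli, Measure.finsetSum_apply]
    rfl

end Selection

/-! ### Construction of an Ewens selection. -/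

section Existence

/-- On the space of triples `(m, x, w)`, mix over `m`, with Ewens weights, the product of an i.i.d.
sequence and a Dirichlet vector. Each component `Q m` is carried by its own fibre of the first
projection, so conditioning on `M = m` recovers it. -/
theorem exists_isEwensSelection {Ω : Type u} [MeasurableSpace Ω] (α : Measure Ω)
    [IsFiniteMeasure α] (hα : α ≠ 0) (k : ℕ) (hk : 0 < k) :
    ∃ (Θ : Type u) (_ : MeasurableSpace Θ) (μ : Measure Θ)
      (M : Θ → Fin k → ℕ) (X : ℕ → Θ → Ω) (W : ℕ → Θ → ℝ),
      IsProbabilityMeasure μ ∧ IsEwensSelection k α μ M X W := by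
  classical
  set a := α.real Set.univ with ha
  have hpos : 0 < a := measureReal_univ_pos hα
  have hρ := isProbabilityMeasure_normalized hα
  set ρ := (α Set.univ)⁻¹ • α
  let D : (m : Fin k → ℕ) → Measure (Fin (numParts m) → ℝ) := fun m =>
    dirichlet fun t : Fin (numParts m) => (part m t : ℝ)
  have hD : ∀ m ∈ ofWeight k k, IsProbabilityMeasure (D m) := fun m hm =>
    isProbabilityMeasure_dirichlet_part (by rw [mem_ofWeight.1 hm]; exact hk)
  -- Padding by zeros puts weight vectors of varying length into one space; entries from `numParts
  -- m` on are unconstrained.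
  let pad : (m : Fin k → ℕ) → (Fin (numParts m) → ℝ) → ℕ → ℝ := fun m w t =>
    if h : t < numParts m then w ⟨t, h⟩ else 0
  have hpad : ∀ m, Measurable (pad m) := by
    intro m
    refine measurable_pi_lambda _ fun t => ?_
    by_cases h : t < numParts m
    · simpa [pad, h] using measurable_pi_apply _
    · simp [pad, h]
  let κ : (Fin k → ℕ) → Measure ((ℕ → Ω) × (ℕ → ℝ)) := fun m =>
    (Measure.infinitePi fun _ : ℕ => ρ).prod ((D m).map (pad m))
  let Q : (Fin k → ℕ) → Measure ((Fin k → ℕ) × (ℕ → Ω) × (ℕ → ℝ)) := fun m =>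
    (κ m).map (Prod.mk m)
  have hκ : ∀ m ∈ ofWeight k k, IsProbabilityMeasure (κ m) := by
    intro m hm
    have := hD m hm
    have : IsProbabilityMeasure ((D m).map (pad m)) :=
      Measure.isProbabilityMeasure_map (hpad m).aemeasurable
    infer_instance
  have hQ : ∀ m ∈ ofWeight k k, IsProbabilityMeasure (Q m) := by
    intro m hm
    have := hκ m hm
    exact Measure.isProbabilityMeasure_map measurable_prodMk_left.aemeasurable
  let w : (Fin k → ℕ) → ℝ≥0∞ := fun m =>
    ENNReal.ofReal (ewensCoeff m * a ^ (∑ j, m j) / poch a k)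
  let μ : Measure ((Fin k → ℕ) × (ℕ → Ω) × (ℕ → ℝ)) := ∑ m ∈ ofWeight k k, w m • Q m
  have hμ : IsProbabilityMeasure μ := by
    constructor
    rw [Measure.finsetSum_apply, ← sum_ewens_weight k hpos]
    refine Finset.sum_congr rfl fun m hm => ?_
    have := hQ m hm
    simp [w]
  have hQin : ∀ m, ∀ E, MeasurableSet E → Q m (Prod.fst ⁻¹' {m} ∩ E) = Q m E := by
    intro m E hE
    have hs := (measurable_fst (measurableSet_singleton m) :
      MeasurableSet ((Prod.fst : (Fin k → ℕ) × (ℕ → Ω) × (ℕ → ℝ) → _) ⁻¹' {m}))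
    rw [Measure.map_apply measurable_prodMk_left (hs.inter hE),
      Measure.map_apply measurable_prodMk_left hE]
    congr 1
    ext x
    simp
  have hQout : ∀ m m', m' ≠ m → ∀ E, MeasurableSet E → Q m' (Prod.fst ⁻¹' {m} ∩ E) = 0 := by
    intro m m' hne E hE
    have hs := (measurable_fst (measurableSet_singleton m) :
      MeasurableSet ((Prod.fst : (Fin k → ℕ) × (ℕ → Ω) × (ℕ → ℝ) → _) ⁻¹' {m}))
    rw [Measure.map_apply measurable_prodMk_left (hs.inter hE)]
    convert measure_empty (μ := κ m')
    ext x
    simp [hne]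
  have hμE : ∀ m ∈ ofWeight k k, ∀ E, MeasurableSet E →
      μ (Prod.fst ⁻¹' {m} ∩ E) = w m * Q m E := by
    intro m hm E hE
    rw [Measure.finsetSum_apply, Finset.sum_eq_single m]
    · rw [Measure.smul_apply, smul_eq_mul, hQin m E hE]
    · intro m' _ hne
      rw [Measure.smul_apply, smul_eq_mul, hQout m m' hne E hE, mul_zero]
    · exact fun h => absurd hm h
  have hμm : ∀ m ∈ ofWeight k k, μ (Prod.fst ⁻¹' {m}) = w m := by
    intro m hm
    have := hQ m hm
    have h := hμE m hm Set.univ MeasurableSet.univ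
    rwa [Set.inter_univ, measure_univ, mul_one] at h
  have hμ0 : ∀ m ∉ ofWeight k k, μ (Prod.fst ⁻¹' {m}) = 0 := by
    intro m hm
    rw [Measure.finsetSum_apply]
    refine Finset.sum_eq_zero fun m' hm' => ?_
    have h := hQout m m' (fun h => hm (h ▸ hm')) Set.univ MeasurableSet.univ
    rw [Set.inter_univ] at h
    rw [Measure.smul_apply, h, smul_zero]
  have hcond : ∀ m, μ (Prod.fst ⁻¹' {m}) ≠ 0 → m ∈ ofWeight k k ∧
      cond μ (Prod.fst ⁻¹' {m}) = Q m := by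
    intro m hm
    have hmem : m ∈ ofWeight k k := by
      by_contra h
      exact hm (hμ0 m h)
    refine ⟨hmem, ?_⟩
    ext E hE
    rw [cond_apply (measurable_fst (measurableSet_singleton m)), hμE m hmem E hE, ← hμm m hmem,
      ← mul_assoc, ENNReal.inv_mul_cancel hm (measure_ne_top _ _), one_mul]
  have hXm : ∀ t : ℕ, Measurable fun θ : (Fin k → ℕ) × (ℕ → Ω) × (ℕ → ℝ) => θ.2.1 t := by
    fun_prop
  have hWm : ∀ t : ℕ, Measurable fun θ : (Fin k → ℕ) × (ℕ → Ω) × (ℕ → ℝ) => θ.2.2 t := by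
    fun_prop
  have hXvm : ∀ m : Fin k → ℕ, Measurable fun (θ : (Fin k → ℕ) × (ℕ → Ω) × (ℕ → ℝ))
      (t : Fin (numParts m)) => θ.2.1 t := fun m => measurable_pi_lambda _ fun t => hXm t
  have hWvm : ∀ m : Fin k → ℕ, Measurable fun (θ : (Fin k → ℕ) × (ℕ → Ω) × (ℕ → ℝ))
      (t : Fin (numParts m)) => θ.2.2 t := fun m => measurable_pi_lambda _ fun t => hWm t
  have hjoint : ∀ m ∈ ofWeight k k, (Q m).map (fun θ =>
      ((fun t : Fin (numParts m) => θ.2.1 t), fun t : Fin (numParts m) => θ.2.2 t)) =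
      (Measure.pi fun _ => ρ).prod (D m) := by
    intro m hm
    have := hD m hm
    have hr1 : Measurable fun (x : ℕ → Ω) (t : Fin (numParts m)) => x t := by fun_prop
    have hr2 : Measurable fun (x : ℕ → ℝ) (t : Fin (numParts m)) => x t := by fun_prop
    have hp1 : (Measure.infinitePi fun _ : ℕ => ρ).map
        (fun (x : ℕ → Ω) (t : Fin (numParts m)) => x t) = Measure.pi fun _ => ρ := by
      have hi : iIndepFun (fun (t : ℕ) (x : ℕ → Ω) => x t)
          (Measure.infinitePi fun _ : ℕ => ρ) :=
        iIndepFun_infinitePi (X := fun _ x => x) fun _ => measurable_id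
      have hi2 : iIndepFun (fun (t : Fin (numParts m)) (x : ℕ → Ω) => x t)
          (Measure.infinitePi fun _ : ℕ => ρ) :=
        hi.precomp (g := fun t : Fin (numParts m) => (t : ℕ)) Fin.val_injective
      rw [iIndepFun.map_fun_eq_pi_map (f := fun (t : Fin (numParts m)) (x : ℕ → Ω) => x t)
        (fun t => (measurable_pi_apply _).aemeasurable) hi2]
      congr 1
      exact funext fun t => Measure.infinitePi_map_eval _ _
    have hp2 : ((D m).map (pad m)).map (fun (x : ℕ → ℝ) (t : Fin (numParts m)) => x t) = D m := by
      rw [Measure.map_map hr2 (hpad m)]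
      convert Measure.map_id
      ext w t
      simp [pad]
    rw [Measure.map_map ((hXvm m).prodMk (hWvm m)) measurable_prodMk_left]
    have : IsProbabilityMeasure ((D m).map (pad m)) :=
      Measure.isProbabilityMeasure_map (hpad m).aemeasurable
    have h3 := Measure.map_prod_map (Measure.infinitePi fun _ : ℕ => ρ) ((D m).map (pad m)) hr1 hr2
    rw [hp1, hp2] at h3
    rw [h3]
    rfl
  have hmapX : ∀ m ∈ ofWeight k k, (Q m).map (fun θ (t : Fin (numParts m)) => θ.2.1 t) =
      Measure.pi fun _ => ρ := by
    intro m hm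
    have := hD m hm
    have h := congrArg (Measure.map Prod.fst) (hjoint m hm)
    rwa [Measure.map_map measurable_fst ((hXvm m).prodMk (hWvm m)), Measure.map_fst_prod,
      measure_univ, one_smul] at h
  have hmapW : ∀ m ∈ ofWeight k k, (Q m).map (fun θ (t : Fin (numParts m)) => θ.2.2 t) = D m := by
    intro m hm
    have := hD m hm
    have h := congrArg (Measure.map Prod.snd) (hjoint m hm)
    rwa [Measure.map_map measurable_snd ((hXvm m).prodMk (hWvm m)), Measure.map_snd_prod,
      measure_univ, one_smul] at h
  have hlawX : ∀ m ∈ ofWeight k k, ∀ t : Fin (numParts m), (Q m).map (fun θ => θ.2.1 t) = ρ := by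
    intro m hm t
    have h := congrArg (Measure.map (Function.eval t)) (hmapX m hm)
    rw [Measure.map_map (measurable_pi_apply t) (hXvm m),
      (measurePreserving_eval (fun _ => ρ) t).map_eq] at h
    exact h
  refine ⟨(Fin k → ℕ) × (ℕ → Ω) × (ℕ → ℝ), inferInstance, μ, Prod.fst, fun t θ => θ.2.1 t,
    fun t θ => θ.2.2 t, hμ, ?_⟩
  refine ⟨measurable_fst, hXm, hWm, ⟨measurable_fst.aemeasurable, ?_⟩, ?_, ?_, ?_, ?_⟩
  · refine Measure.ext_of_singleton fun m => ?_
    rw [Measure.map_apply measurable_fst (measurableSet_singleton m)]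
    by_cases hm : m ∈ ofWeight k k
    · rw [hμm m hm, ewens_apply hm]
    · rw [hμ0 m hm]
      symm
      refine measure_mono_null ?_ (ae_iff.1 (ae_ewens k a))
      rintro _ rfl
      exact hm
  · intro m hm t ht
    obtain ⟨hmem, hc⟩ := hcond m hm
    rw [hc]
    exact ⟨(hXm t).aemeasurable, hlawX m hmem ⟨t, ht⟩⟩
  · intro m hm
    obtain ⟨hmem, hc⟩ := hcond m hm
    have := hQ m hmem
    rw [hc]
    refine (iIndepFun_iff_map_fun_eq_pi_map (f := fun (t : Fin (numParts m))
      (θ : (Fin k → ℕ) × (ℕ → Ω) × (ℕ → ℝ)) => θ.2.1 t) fun t => (hXm t).aemeasurable).2 ?_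
    rw [hmapX m hmem]
    congr 1
    exact funext fun t => (hlawX m hmem t).symm
  · intro m hm
    obtain ⟨hmem, hc⟩ := hcond m hm
    rw [hc]
    exact ⟨(hWvm m).aemeasurable, hmapW m hmem⟩
  · intro m hm
    obtain ⟨hmem, hc⟩ := hcond m hm
    have := hQ m hmem
    rw [hc, indepFun_iff_map_prod_eq_prod_map_map (hXvm m).aemeasurable (hWvm m).aemeasurable,
      hjoint m hmem, hmapX m hmem, hmapW m hmem]

end Existence

end QuasiBernoulli

theorem theorem5p1 {Ω : Type u} [MeasurableSpace Ω] (α : MeasureTheory.Measure Ω)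
    [MeasureTheory.IsFiniteMeasure α] (hα : α ≠ 0) (k : ℕ) (hk : 0 < k) :
    (∃ (Θ : Type u) (_ : MeasurableSpace Θ) (μ : MeasureTheory.Measure Θ)
      (M : Θ → Fin k → ℕ) (X : ℕ → Θ → Ω) (W : ℕ → Θ → ℝ),
      MeasureTheory.IsProbabilityMeasure μ ∧ QuasiBernoulli.IsEwensSelection k α μ M X W) ∧
    (∀ (Θ : Type v) [MeasurableSpace Θ] (μ : MeasureTheory.Measure Θ)
      [MeasureTheory.IsProbabilityMeasure μ]
      (M : Θ → Fin k → ℕ) (X : ℕ → Θ → Ω) (W : ℕ → Θ → ℝ),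
      QuasiBernoulli.IsEwensSelection k α μ M X W →
      QuasiBernoulli.IsQuasiBernoulliProcess k α μ (QuasiBernoulli.randomMeasure M X W)) :=
  ⟨QuasiBernoulli.exists_isEwensSelection α hα k hk,
    fun _ _ _ _ _ _ _ h => h.quasiBernoulli_randomMeasure hα hk⟩
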